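/- For $\varepsilon>0$ let $g_\varepsilon$ be the Möbius map with $g_\varepsilon(0)=0$, $g_\varepsilon'(0)=1+\varepsilon$, $g_\varepsilon(\tfrac1{20})=1$, i.e. $g_\varepsilon(x)=\frac{(1+\varepsilon)x}{1-(19-\varepsilon)x}$, and let $F_0,F_1$ be the partially defined maps of $[0,1]$ with domain $[0,\tfrac1{20}]\cup[\tfrac{19}{20},1]$ given by $$F_0(x)=\begin{cases} g_\varepsilon(x), & x\in[0,\tfrac1{20}],\\ 20x-19, & x\in[\tfrac{19}{20},1],\end{cases}\qquad F_1(x)=1-F_0(1-x).$$ For $\tau>0$, a $C^{1+\tau}$ cookie-cutter map on $[0,1]$ is a map $F$ defined on a finite disjoint union of nondegenerate closed subintervals of $[0,1]$ which maps each of these intervals diffeomorphically onto $[0,1]$, with $|F'|>1$ and with $\tau$-Hölder derivative on each of them. For a partially defined map $F$ let $J(F)$ be the set of $x\in[0,1]$ at which all iterates $F^n$ are defined, and for a sequence $\bar c=(c_n)_{n\ge1}$ in $\{0,1\}$ let $J_{\bar c}$ be the set of $x\in[0,1]$ at which $F_{c_n}\circ\dots\circ F_{c_1}$ is defined for all $n$.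 Write $F_0F_1=F_0\circ F_1$, defined where $F_1$ is defined with value in the domain of $F_0$. Call $\varepsilon>0$ admissible if $F_0$ and $F_1$ are $C^{1+\tau}$ cookie-cutter maps for some common $\tau>0$ and $$\dim_H J(F_0F_1)<\tfrac1{2.01}<\dim_H J(F_0)=\dim_H J(F_1).$$ **Claim.** (1) There is $\varepsilon_0>0$ such that every $\varepsilon\in(0,\varepsilon_0)$ is admissible. (2) Let $\varepsilon>0$ be admissible, let $(l_j)_{j\ge1}$ be positive integers with $l_{j+1}/l_j\to\infty$, and let $$\bar c=(00)^{l_1}(11)^{l_2}(01)^{l_3}\cdots(00)^{l_{3m+1}}(11)^{l_{3m+2}}(01)^{l_{3m+3}}\cdots,$$ where powers are repetitions and products are concatenations of words. Then $$\dim_H J_{\bar c}=\dim_H J(F_0F_1)<\dim_H J(F_0)=\dim_H J(F_1).$$ Moreover, $\bar c$ satisfies the frequencies condition $\limsup_{n\to\infty}\frac1n\#\{m\le n: c_m=j\}=1$ for $j=0,1$, but it does not switch rarely: $\kappa_n:=\#\{m<n: c_m\ne c_{m+1}\}$ is not $o(n)$. In particular $\dim_H J_{\bar c}\neq\min_{j=0,1}\dim_H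 J(F_j)$, so the formula $\dim_H J_{\bar c}=\min_j\dim_H J(F_j)$ can fail for sequences that satisfy the frequencies condition but do not switch rarely. -/

import Mathlib

open Set Filter Topology
open scoped NNReal ENNReal

/-! Partial maps of the line are `ℝ →. ℝ`; `F.comp G` is "first `G`, then `F`", defined at `x`
exactly when `G` is defined at `x` and `F` is defined at `G x`. The base interval is `[0, 1]`. -/

/-- A `C^{1+τ}` cookie-cutter map on `[0, 1]`: its domain is a finite disjoint union of nondegenerate
closed subintervals of `[0, 1]`, each of which it maps diffeomorphically onto `[0, 1]`, with
derivative `> 1` in absolute value and `τ`-Hölder continuous (one-sided at the endpoints). -/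
def IsCookieCutter (τ : ℝ≥0) (F : ℝ →. ℝ) : Prop :=
  ∃ (q : ℕ) (a b : Fin q → ℝ) (f : ℝ → ℝ),
    (∀ i, a i < b i ∧ Icc (a i) (b i) ⊆ Icc 0 1) ∧
    (∀ i j, i ≠ j → Disjoint (Icc (a i) (b i)) (Icc (a j) (b j))) ∧
    F.Dom = ⋃ i, Icc (a i) (b i) ∧
    (∀ x ∈ F.Dom, f x ∈ F x) ∧
    ∀ i, BijOn f (Icc (a i) (b i)) (Icc 0 1) ∧
      ContDiffOn ℝ 1 f (Icc (a i) (b i)) ∧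
      (∀ x ∈ Icc (a i) (b i), 1 < |derivWithin f (Icc (a i) (b i)) x|) ∧
      ∃ C : ℝ≥0, HolderOnWith C τ (derivWithin f (Icc (a i) (b i))) (Icc (a i) (b i))

/-- The composition `G (n-1) ∘ ⋯ ∘ G 0` of the first `n` partial maps of a sequence. -/
def sequentialComp (G : ℕ → ℝ →. ℝ) : ℕ → (ℝ →. ℝ)
  | 0 => PFun.id ℝ
  | n + 1 => (G n).comp (sequentialComp G n)

/-- The cookie-cutter set `J(F)`: the points of `[0, 1]` at which all iterates of `F` are defined. -/
def cookieCutterSet (F : ℝ →. ℝ) : Set ℝ :=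
  {x | x ∈ Icc (0 : ℝ) 1 ∧ ∀ n, x ∈ (sequentialComp (fun _ => F) n).Dom}

/-- The cookie-cutter-like set `J(𝓕; c)`: the points of `[0, 1]` at which all the compositions
`F (c (n-1)) ∘ ⋯ ∘ F (c 0)` are defined. (The sequence `c` is indexed from `0`.) -/
def cookieCutterLikeSet {ι : Type*} (F : ι → ℝ →. ℝ) (c : ℕ → ι) : Set ℝ :=
  {x | x ∈ Icc (0 : ℝ) 1 ∧ ∀ n, x ∈ (sequentialComp (fun m => F (c m)) n).Dom}

/-- The number `κ_n` of switches among the first `n` letters of `c`. -/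
def switchCount {ι : Type*} [DecidableEq ι] (c : ℕ → ι) (n : ℕ) : ℕ :=
  ((Finset.range (n - 1)).filter fun m => c m ≠ c (m + 1)).card

/-- `c` switches rarely: `κ_n = o(n)`. -/
def RarelySwitching {ι : Type*} [DecidableEq ι] (c : ℕ → ι) : Prop :=
  (fun n => (switchCount c n : ℝ)) =o[atTop] fun n : ℕ => (n : ℝ)

/-- The frequency of the letter `j` among the first `n` letters of `c`. -/
noncomputable def letterFreq {ι : Type*} [DecidableEq ι] (c : ℕ → ι) (n : ℕ) (j : ι) : ℝ :=
  (((Finset.range n).filter fun m => c m = j).card : ℝ) / n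

/-- The frequencies condition: every letter has upper frequency `1`. -/
def FrequenciesCondition {ι : Type*} [DecidableEq ι] (c : ℕ → ι) : Prop :=
  ∀ j, limsup (fun n => letterFreq c n j) atTop = 1

/-- The Möbius map `g` with `g 0 = 0`, `g' 0 = 1 + ε`, `g (1/20) = 1`. -/
noncomputable def moebiusBranch (ε x : ℝ) : ℝ :=
  (1 + ε) * x / (1 - (19 - ε) * x)

/-- The defining properties of the Möbius branch (a Möbius map is determined by them). -/
theorem moebiusBranch_spec {ε : ℝ} (hε : 0 < ε) :
    moebiusBranch ε 0 = 0 ∧ HasDerivAt (moebiusBranch ε) (1 + ε) 0 ∧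
      moebiusBranch ε (1 / 20) = 1 := by
  refine ⟨by simp [moebiusBranch], ?_, ?_⟩
  · have h1 : HasDerivAt (fun x : ℝ => (1 + ε) * x) ((1 + ε) * 1) 0 :=
      (hasDerivAt_id (0 : ℝ)).const_mul (1 + ε)
    have h2 : HasDerivAt (fun x : ℝ => 1 - (19 - ε) * x) (-((19 - ε) * 1)) 0 :=
      ((hasDerivAt_id (0 : ℝ)).const_mul (19 - ε)).const_sub 1
    have h3 := h1.div h2 (by simp)
    have h4 : HasDerivAt (moebiusBranch ε) _ 0 := h3
    simpa using h4
  · have h : (1 : ℝ) - (19 - ε) * (1 / 20) = (1 + ε) * (1 / 20) := by ring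
    rw [moebiusBranch, h]
    exact div_self (by positivity)

/-- `F₀`, with domain `[0, 1/20] ∪ [19/20, 1]`: the Möbius branch on the first interval, the affine
map `20 x - 19` on the second. -/
noncomputable def exampleMapZero (ε : ℝ) : ℝ →. ℝ :=
  PFun.res (fun x => if x ≤ 1 / 20 then moebiusBranch ε x else 20 * x - 19)
    (Icc 0 (1 / 20) ∪ Icc (19 / 20) 1)

/-- `F₁ x = 1 - F₀ (1 - x)`. -/
noncomputable def exampleMapOne (ε : ℝ) : ℝ →. ℝ :=
  fun x => (exampleMapZero ε (1 - x)).map fun y => 1 - y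

/-- The pair `(F₀, F₁)`. -/
noncomputable def exampleMap (ε : ℝ) : Fin 2 → ℝ →. ℝ :=
  ![exampleMapZero ε, exampleMapOne ε]

/-- `F₀` and `F₁` are `C^{1+τ}` cookie-cutter maps for some common `τ > 0`, and
`dim J(F₀F₁) < 1/2.01 < dim J(F₀) = dim J(F₁)`. -/
def IsAdmissibleParameter (ε : ℝ) : Prop :=
  (∃ τ : ℝ≥0, 0 < τ ∧ ∀ i, IsCookieCutter τ (exampleMap ε i)) ∧
  dimH (cookieCutterSet ((exampleMap ε 0).comp (exampleMap ε 1))) < ENNReal.ofReal (1 / 2.01) ∧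
  ENNReal.ofReal (1 / 2.01) < dimH (cookieCutterSet (exampleMap ε 0)) ∧
  dimH (cookieCutterSet (exampleMap ε 0)) = dimH (cookieCutterSet (exampleMap ε 1))

/-- The two-letter words `00`, `11`, `01`, repeated with period three. -/
def blockWord (j : ℕ) : Fin 2 → Fin 2 :=
  if j % 3 = 0 then ![0, 0] else if j % 3 = 1 then ![1, 1] else ![0, 1]

/-- The sequence `(00)^{l 0} (11)^{l 1} (01)^{l 2} (00)^{l 3} ⋯`: the `m`-th pair of letters
(counted from `0`) is the word of the first block `j` with `m < l 0 + ⋯ + l j`. -/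
noncomputable def blockSequence (l : ℕ → ℕ) (n : ℕ) : Fin 2 :=
  blockWord (sInf {j | n / 2 < ∑ i ∈ Finset.range (j + 1), l i}) ⟨n % 2, Nat.mod_lt n (by norm_num)⟩

/-! Everything is read off the inverse branches. For a Möbius inverse branch the difference `f x - f
y` is `(x - y) * (m x * m y)`, and this form survives composition, so all compositions have
distortion bounded by one constant. Hence the sum of the `s`-th powers of the cylinder lengths,
`lengthSum`, is submultiplicative up to that constant. For a periodic sequence of letters the
dimension is then a threshold: the sums decay geometrically for larger `s`
(`exists_lengthSum_le_geometric`) and eventually exceed any constant for smaller `s`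
(`eventually_le_lengthSum`).

For the block sequence, `l (j + 1) / l j → ∞` makes everything before a block negligible against
that block. At the ends of the `(01)` blocks the sums are therefore bounded as soon as `s` exceeds
the dimension of the alternating system, and covers along a subsequence suffice for an upper bound
on Hausdorff dimension. Conversely, if `s` is below the dimensions of all three periodic systems
`00`, `11`, `01`, the sequence can be cut into pieces of bounded length, each inside one block and
each with `s`-sum above the distortion constant; mass distribution over the pieces
(`le_dimH_of_lower_ratios`) gives dimension at least `s`. So the dimension is the smallest of the
three, which by admissibility is the one for `01`.

Admissibility for small `ε` rests on a near-parabolic fixed point. Near `0` the Möbius branch `φ₀`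
of the inverse of `F₀` is almost neutral, so the induced maps `φ₀ⁿ ∘ φ₁` contract only like `n⁻²`;
the square roots of the ratios form a harmonic series, and the dimension is at least `1/2`. The slow
point of `F₁` is at the opposite end, so in `F₀ ∘ F₁` no slow passage can build up: its four inverse
branches contract by at most `1/16` or `1/256`, and the dimension is at most `3/8`. -/

open MeasureTheory in
/-- A finite family of nonnegative weights of total mass at least `1` dominates a probability
measure. -/
theorem exists_isProbabilityMeasure_singleton_le {ι : Type*} [Fintype ι] [MeasurableSpace ι]
    [MeasurableSingletonClass ι] (a : ι → ℝ) (ha : ∀ i, 0 ≤ a i) (hsum : 1 ≤ ∑ i, a i) :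
    ∃ ν : Measure ι, IsProbabilityMeasure ν ∧ ∀ i, ν {i} ≤ ENNReal.ofReal (a i) := by
  set A : ℝ := ∑ i, a i
  have hA : 0 < A := by linarith
  have h1 : ∑ i, ENNReal.ofReal (a i / A) = 1 := by
    rw [← ENNReal.ofReal_sum_of_nonneg fun i _ => div_nonneg (ha i) hA.le, ← Finset.sum_div,
      div_self hA.ne', ENNReal.ofReal_one]
  refine ⟨(PMF.ofFintype _ h1).toMeasure, inferInstance, fun i => ?_⟩
  rw [PMF.toMeasure_apply_singleton _ _ (measurableSet_singleton i), PMF.ofFintype_apply]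
  exact ENNReal.ofReal_le_ofReal (div_le_self (ha i) hsum)

/-! ### Nonautonomous iterated function systems and mass distribution. -/

section NonautonomousIFS

/-- The composition `φ 0 (w 0) ∘ ⋯ ∘ φ (n - 1) (w (n - 1))` along a sequence of symbols. -/
def nestedComp {ι : ℕ → Type*} (φ : ∀ k, ι k → ℝ → ℝ) (w : ∀ k, ι k) : ℕ → ℝ → ℝ
  | 0 => id
  | n + 1 => nestedComp φ w n ∘ φ n (w n)

variable {ι : ℕ → Type*} {φ : ∀ k, ι k → ℝ → ℝ}

theorem nestedComp_congr {w w' : ∀ k, ι k} {n : ℕ} (h : ∀ k < n, w k = w' k) :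
    nestedComp φ w n = nestedComp φ w' n := by
  induction n with
  | zero => rfl
  | succ n ih =>
    rw [nestedComp, nestedComp, ih fun k hk => h k (hk.trans n.lt_succ_self), h n n.lt_succ_self]

theorem nestedComp_dist_le (hmaps : ∀ k i, MapsTo (φ k i) (Icc 0 1) (Icc 0 1)) {ρ : ℝ}
    (hρ : 0 ≤ ρ)
    (hup : ∀ k i, ∀ x ∈ Icc (0 : ℝ) 1, ∀ y ∈ Icc (0 : ℝ) 1, |φ k i x - φ k i y| ≤ ρ * |x - y|)
    (w : ∀ k, ι k) (n : ℕ) {x y : ℝ} (hx : x ∈ Icc (0 : ℝ) 1) (hy : y ∈ Icc (0 : ℝ) 1) :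
    |nestedComp φ w n x - nestedComp φ w n y| ≤ ρ ^ n * |x - y| := by
  induction n generalizing x y with
  | zero => simp [nestedComp]
  | succ n ih =>
    calc _ ≤ ρ ^ n * |φ n (w n) x - φ n (w n) y| := ih (hmaps _ _ hx) (hmaps _ _ hy)
      _ ≤ ρ ^ n * (ρ * |x - y|) := by gcongr; exact hup _ _ x hx y hy
      _ = _ := by ring

theorem le_nestedComp_dist (hmaps : ∀ k i, MapsTo (φ k i) (Icc 0 1) (Icc 0 1))
    {c : ∀ k, ι k → ℝ} (hc : ∀ k i, 0 < c k i)
    (hlow : ∀ k i, ∀ x ∈ Icc (0 : ℝ) 1, ∀ y ∈ Icc (0 : ℝ) 1, c k i * |x - y| ≤ |φ k i x - φ k i y|)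
    (w : ∀ k, ι k) (n : ℕ) {x y : ℝ} (hx : x ∈ Icc (0 : ℝ) 1) (hy : y ∈ Icc (0 : ℝ) 1) :
    (∏ k ∈ Finset.range n, c k (w k)) * |x - y| ≤ |nestedComp φ w n x - nestedComp φ w n y| := by
  induction n generalizing x y with
  | zero => simp [nestedComp]
  | succ n ih =>
    have h0 : 0 ≤ ∏ k ∈ Finset.range n, c k (w k) := Finset.prod_nonneg fun k _ => (hc k _).le
    calc _ = (∏ k ∈ Finset.range n, c k (w k)) * (c n (w n) * |x - y|) := by
          rw [Finset.prod_range_succ]; ring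
      _ ≤ (∏ k ∈ Finset.range n, c k (w k)) * |φ n (w n) x - φ n (w n) y| := by
          gcongr; exact hlow _ _ x hx y hy
      _ ≤ _ := ih (hmaps _ _ hx) (hmaps _ _ hy)

theorem measurable_nestedComp [∀ k, Countable (ι k)] [∀ k, MeasurableSpace (ι k)]
    [∀ k, MeasurableSingletonClass (ι k)] (hmeas : ∀ k i, Measurable (φ k i)) (n : ℕ)
    {f : (∀ k, ι k) → ℝ} (hf : Measurable f) : Measurable fun w => nestedComp φ w n (f w) := by
  induction n generalizing f with
  | zero => exact hf
  | succ n ih =>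
    refine ih (f := fun w => φ n (w n) (f w)) ?_
    have h : Measurable fun p : ι n × ℝ => φ n p.1 p.2 :=
      measurable_from_prod_countable_right fun i => hmeas n i
    exact h.comp ((measurable_pi_apply n).prodMk hf)

/-- The coding map of a uniformly contracting sequence of families. -/
theorem exists_measurable_coding [∀ k, Countable (ι k)] [∀ k, MeasurableSpace (ι k)]
    [∀ k, MeasurableSingletonClass (ι k)]
    (hmaps : ∀ k i, MapsTo (φ k i) (Icc 0 1) (Icc 0 1)) (hmeas : ∀ k i, Measurable (φ k i))
    {ρ : ℝ} (hρ0 : 0 ≤ ρ) (hρ : ρ < 1)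
    (hup : ∀ k i, ∀ x ∈ Icc (0 : ℝ) 1, ∀ y ∈ Icc (0 : ℝ) 1, |φ k i x - φ k i y| ≤ ρ * |x - y|) :
    ∃ π : (∀ k, ι k) → ℝ, Measurable π ∧ ∀ w n, π w ∈ nestedComp φ w n '' Icc 0 1 := by
  have h0 : (0 : ℝ) ∈ Icc (0 : ℝ) 1 := by simp
  have hcauchy : ∀ w, CauchySeq fun n => nestedComp φ w n 0 := fun w => by
    refine cauchySeq_of_le_geometric ρ 1 hρ fun n => ?_
    have h := nestedComp_dist_le hmaps hρ0 hup w n h0 (hmaps n (w n) h0)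
    have h1 := hmaps n (w n) h0
    have h2 : |0 - φ n (w n) 0| ≤ 1 := by
      rw [zero_sub, abs_neg, abs_of_nonneg h1.1]; exact h1.2
    rw [Real.dist_eq, one_mul]
    exact h.trans (mul_le_of_le_one_right (pow_nonneg hρ0 n) h2)
  choose π hπ using fun w => cauchySeq_tendsto_of_complete (hcauchy w)
  refine ⟨π, measurable_of_tendsto_metrizable
    (fun n => measurable_nestedComp hmeas n measurable_const) (tendsto_pi_nhds.2 hπ), ?_⟩
  intro w n
  have hcont : ContinuousOn (nestedComp φ w n) (Icc 0 1) := by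
    refine (LipschitzOnWith.of_dist_le_mul (K := ⟨ρ ^ n, pow_nonneg hρ0 n⟩) ?_).continuousOn
    exact fun x hx y hy => nestedComp_dist_le hmaps hρ0 hup w n hx hy
  have hmem : ∀ m, nestedComp φ w (n + m) 0 ∈ nestedComp φ w n '' Icc 0 1 := by
    have : ∀ m, ∀ x ∈ Icc (0 : ℝ) 1, nestedComp φ w (n + m) x ∈ nestedComp φ w n '' Icc 0 1 := by
      intro m
      induction m with
      | zero => exact fun x hx => mem_image_of_mem _ hx
      | succ m ih => exact fun x hx => ih _ (hmaps _ _ hx)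
    exact fun m => this m 0 h0
  exact (isCompact_Icc.image_of_continuousOn hcont).isClosed.mem_of_tendsto
    (hπ w) (eventually_atTop.2 ⟨n, fun m hm => by
      obtain ⟨k, rfl⟩ := Nat.exists_eq_add_of_le hm
      exact hmem k⟩)

open MeasureTheory in
/-- **Mass distribution for a nonautonomous iterated function system.** If the lower ratios at each
step have `s`-th powers summing to at least `1`, and distinct images at each step are uniformly
separated, then the limit set has dimension at least `s`. -/
theorem le_dimH_of_lower_ratios [∀ k, Fintype (ι k)]
    (hmaps : ∀ k i, MapsTo (φ k i) (Icc 0 1) (Icc 0 1)) (hmeas : ∀ k i, Measurable (φ k i))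
    {ρ : ℝ} (hρ : ρ < 1)
    (hup : ∀ k i, ∀ x ∈ Icc (0 : ℝ) 1, ∀ y ∈ Icc (0 : ℝ) 1, |φ k i x - φ k i y| ≤ ρ * |x - y|)
    {c : ∀ k, ι k → ℝ} (hc : ∀ k i, 0 < c k i)
    (hlow : ∀ k i, ∀ x ∈ Icc (0 : ℝ) 1, ∀ y ∈ Icc (0 : ℝ) 1, c k i * |x - y| ≤ |φ k i x - φ k i y|)
    {δ : ℝ} (hδ : 0 < δ)
    (hsep : ∀ k i j, i ≠ j → ∀ x ∈ Icc (0 : ℝ) 1, ∀ y ∈ Icc (0 : ℝ) 1, δ ≤ |φ k i x - φ k j y|)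
    {s : ℝ≥0} (hsum : ∀ k, 1 ≤ ∑ i, c k i ^ (s : ℝ)) :
    (s : ℝ≥0∞) ≤ dimH {x | ∃ w : ∀ k, ι k, ∀ n, x ∈ nestedComp φ w n '' Icc 0 1} := by
  rcases (zero_le : (0 : ℝ≥0) ≤ s).eq_or_lt with rfl | hs
  · simp
  have hs' : (0 : ℝ) < s := hs
  let _ : ∀ k, MeasurableSpace (ι k) := fun _ => ⊤
  have hcρ : ∀ k i, c k i ≤ ρ := fun k i => by
    simpa using (hlow k i 1 (by simp) 0 (by simp)).trans (hup k i 1 (by simp) 0 (by simp))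
  have hne : ∀ k, Nonempty (ι k) := fun k => by
    by_contra h
    rw [not_nonempty_iff] at h
    have := hsum k
    rw [Finset.univ_eq_empty, Finset.sum_empty] at this
    linarith
  have hρ0 : 0 ≤ ρ := (hc 0 (hne 0).some).le.trans (hcρ _ _)
  obtain ⟨π, hπm, hπ⟩ := exists_measurable_coding hmaps hmeas hρ0 hρ hup
  choose ν hνp hν using fun k => exists_isProbabilityMeasure_singleton_le (fun i => c k i ^ (s : ℝ))
    (fun i => (Real.rpow_pos_of_pos (hc k i) _).le) (hsum k)
  set μ : Measure (∀ k, ι k) := Measure.infinitePi ν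
  -- The product measure gives a cylinder at most the `s`-th power of its lower ratio product.
  have hcyl : ∀ (w : ∀ k, ι k) (n : ℕ) (S : Set (∀ k, ι k)), (∀ w' ∈ S, ∀ k < n, w' k = w k) →
      μ S ≤ ENNReal.ofReal (∏ k ∈ Finset.range n, c k (w k)) ^ (s : ℝ) := by
    intro w n S hS
    calc μ S ≤ μ (Set.pi (Finset.range n : Finset ℕ) fun k => {w k}) :=
          measure_mono fun w' hw' k hk => hS w' hw' k (Finset.mem_range.1 (Finset.mem_coe.1 hk))
      _ = ∏ k ∈ Finset.range n, ν k {w k} :=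
          Measure.infinitePi_pi _ fun k _ => measurableSet_singleton _
      _ ≤ ∏ k ∈ Finset.range n, ENNReal.ofReal (c k (w k) ^ (s : ℝ)) :=
          Finset.prod_le_prod' fun k _ => hν k _
      _ = _ := by
          rw [ENNReal.ofReal_prod_of_nonneg fun k _ => (hc k _).le,
            ← ENNReal.prod_rpow_of_nonneg hs'.le]
          exact Finset.prod_congr rfl fun k _ => (ENNReal.ofReal_rpow_of_pos (hc k _)).symm
  -- Frostman bound. If only one code lies over `U`, its mass is zero, being at most `ρ ^ n` to the
  -- power `s` for every `n`. Otherwise let `n` be the first place where two codes over `U` differ: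
  -- separation at step `n`, pulled through the common prefix, bounds the diameter below by `δ`
  -- times the ratio product of that prefix.
  have hball : ∀ U : Set ℝ,
      μ (π ⁻¹' U) ≤ ENNReal.ofReal δ⁻¹ ^ (s : ℝ) * Metric.ediam U ^ (s : ℝ) := by
    intro U
    by_cases hE : (π ⁻¹' U).Nonempty
    swap
    · rw [not_nonempty_iff_eq_empty.1 hE, measure_empty]; exact zero_le
    obtain ⟨w, hw⟩ := hE
    by_cases hall : ∀ w' ∈ π ⁻¹' U, ∀ k, w' k = w k
    · have hle : ∀ n : ℕ, μ (π ⁻¹' U) ≤ ENNReal.ofReal (ρ ^ n) ^ (s : ℝ) := fun n => by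
        refine (hcyl w n _ fun w' hw' k _ => hall w' hw' k).trans ?_
        gcongr
        calc _ ≤ ∏ k ∈ Finset.range n, ρ :=
              Finset.prod_le_prod (fun k _ => (hc k _).le) fun k _ => hcρ k _
          _ = ρ ^ n := by simp
      have hlim : Tendsto (fun n : ℕ => ENNReal.ofReal (ρ ^ n) ^ (s : ℝ)) atTop (𝓝 0) := by
        have h := (ENNReal.tendsto_ofReal
          (tendsto_pow_atTop_nhds_zero_of_lt_one hρ0 hρ)).ennrpow_const (s : ℝ)
        simpa [ENNReal.zero_rpow_of_pos hs'] using h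
      exact (ge_of_tendsto' hlim hle).trans zero_le
    · push Not at hall
      obtain ⟨w₁, hw₁, k₁, hk₁⟩ := hall
      have hex : ∃ k, ∃ w' ∈ π ⁻¹' U, w' k ≠ w k := ⟨k₁, w₁, hw₁, hk₁⟩
      classical
      set n := Nat.find hex
      obtain ⟨w', hw', hne'⟩ := Nat.find_spec hex
      have hagree : ∀ v ∈ π ⁻¹' U, ∀ k < n, v k = w k := fun v hv k hk => by
        by_contra hne
        exact Nat.find_min hex hk ⟨v, hv, hne⟩
      have hdist : (∏ k ∈ Finset.range n, c k (w k)) * δ ≤ |π w - π w'| := by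
        obtain ⟨x, hx, hxw⟩ := hπ w (n + 1)
        obtain ⟨y, hy, hyw⟩ := hπ w' (n + 1)
        rw [← hxw, ← hyw, nestedComp, nestedComp, nestedComp_congr (hagree w' hw'),
          Function.comp_apply, Function.comp_apply]
        refine le_trans ?_ (le_nestedComp_dist hmaps hc hlow w n (hmaps _ _ hx) (hmaps _ _ hy))
        have h0 : 0 ≤ ∏ k ∈ Finset.range n, c k (w k) := Finset.prod_nonneg fun k _ => (hc k _).le
        gcongr
        exact hsep n _ _ (Ne.symm hne') x hx y hy
      refine (hcyl w n _ hagree).trans ?_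
      rw [← ENNReal.mul_rpow_of_nonneg _ _ hs'.le]
      gcongr
      calc ENNReal.ofReal (∏ k ∈ Finset.range n, c k (w k))
          ≤ ENNReal.ofReal (δ⁻¹ * |π w - π w'|) := by
            refine ENNReal.ofReal_le_ofReal ?_
            rw [inv_mul_eq_div, le_div_iff₀ hδ]; exact hdist
        _ = ENNReal.ofReal δ⁻¹ * edist (π w) (π w') := by
            rw [ENNReal.ofReal_mul (inv_nonneg.2 hδ.le), edist_dist, Real.dist_eq]
        _ ≤ _ := by gcongr; exact Metric.edist_le_ediam_of_mem hw hw'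
  set J := {x | ∃ w : ∀ k, ι k, ∀ n, x ∈ nestedComp φ w n '' Icc 0 1}
  set a : ℝ≥0∞ := ENNReal.ofReal δ ^ (s : ℝ)
  have ha0 : a ≠ 0 := (ENNReal.rpow_pos (by simpa using hδ) ENNReal.ofReal_ne_top).ne'
  have hle : a • μ.map π ≤ Measure.hausdorffMeasure (s : ℝ) := by
    refine Measure.le_hausdorffMeasure _ _ 1 one_pos fun U _ => ?_
    have h1 : μ.map π U ≤ ENNReal.ofReal δ⁻¹ ^ (s : ℝ) * Metric.ediam U ^ (s : ℝ) := by
      -- `U` need not be measurable; its closure is, and has the same diameter.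
      calc μ.map π U ≤ μ.map π (closure U) := measure_mono subset_closure
        _ = μ (π ⁻¹' closure U) := Measure.map_apply hπm isClosed_closure.measurableSet
        _ ≤ _ := by
          have := hball (closure U)
          rwa [Metric.ediam_closure] at this
    rw [Measure.smul_apply, smul_eq_mul]
    calc a * μ.map π U ≤ a * (ENNReal.ofReal δ⁻¹ ^ (s : ℝ) * Metric.ediam U ^ (s : ℝ)) := by gcongr
      _ = _ := by
        rw [← mul_assoc, ← ENNReal.mul_rpow_of_nonneg _ _ hs'.le,
          ← ENNReal.ofReal_mul hδ.le, mul_inv_cancel₀ hδ.ne', ENNReal.ofReal_one,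
          ENNReal.one_rpow, one_mul]
  refine le_dimH_of_hausdorffMeasure_ne_zero fun hzero => ?_
  have h2 : μ.map π J = 0 := by
    have h3 := hle J
    rw [hzero, Measure.smul_apply, smul_eq_mul, nonpos_iff_eq_zero, mul_eq_zero] at h3
    exact h3.resolve_left ha0
  have h4 : (1 : ℝ≥0∞) ≤ μ.map π J := by
    calc (1 : ℝ≥0∞) = μ univ := measure_univ.symm
      _ ≤ μ (π ⁻¹' J) := measure_mono fun w _ => ⟨w, hπ w⟩
      _ ≤ μ.map π J := Measure.le_map_apply hπm.aemeasurable J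
  rw [h2] at h4
  exact absurd h4 (by simp)

end NonautonomousIFS

/-! ### Elementary bounds for Hausdorff dimension. -/

/-- Covers by finitely many sets of small diameter with bounded `s`-sums bound the dimension. -/
theorem dimH_le_of_frequently_covers {J : Set ℝ} {κ : ℕ → Type*} [∀ n, Fintype (κ n)]
    (t : ∀ n, κ n → Set ℝ) (hcov : ∀ n, J ⊆ ⋃ i, t n i) (r : ∀ n, κ n → ℝ) {ε : ℕ → ℝ}
    (hε : Tendsto ε atTop (𝓝 0)) (hrε : ∀ n i, r n i ≤ ε n) (hr0 : ∀ n i, 0 ≤ r n i)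
    (hdiam : ∀ n i, ∀ x ∈ t n i, ∀ y ∈ t n i, |x - y| ≤ r n i) {s : ℝ≥0} {M : ℝ}
    (hM : ∃ᶠ n in atTop, ∑ i, r n i ^ (s : ℝ) ≤ M) : dimH J ≤ s := by
  have hd : ∀ n i, Metric.ediam (t n i) ≤ ENNReal.ofReal (r n i) := fun n i =>
    Metric.ediam_le fun x hx y hy => by
      rw [edist_dist, Real.dist_eq]; exact ENNReal.ofReal_le_ofReal (hdiam n i x hx y hy)
  refine dimH_le_of_hausdorffMeasure_ne_top (ne_top_of_le_ne_top
    (ENNReal.ofReal_ne_top (r := M)) ?_)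
  refine (MeasureTheory.Measure.hausdorffMeasure_le_liminf_sum (s : ℝ) J
    (r := fun n => ENNReal.ofReal (ε n)) (l := atTop)
    (by simpa using ENNReal.tendsto_ofReal hε) t
    (Eventually.of_forall fun n i => (hd n i).trans (ENNReal.ofReal_le_ofReal (hrε n i)))
    (Eventually.of_forall hcov)).trans ?_
  refine liminf_le_of_frequently_le' (hM.mono fun n hn => ?_)
  calc ∑ i, Metric.ediam (t n i) ^ (s : ℝ) ≤ ∑ i, ENNReal.ofReal (r n i ^ (s : ℝ)) := by
        refine Finset.sum_le_sum fun i _ => ?_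
        rw [← ENNReal.ofReal_rpow_of_nonneg (hr0 n i) s.coe_nonneg]
        exact ENNReal.rpow_le_rpow (hd n i) s.coe_nonneg
    _ = ENNReal.ofReal (∑ i, r n i ^ (s : ℝ)) :=
        (ENNReal.ofReal_sum_of_nonneg fun i _ => Real.rpow_nonneg (hr0 n i) _).symm
    _ ≤ ENNReal.ofReal M := ENNReal.ofReal_le_ofReal hn

/-- Maps that do not contract distances by more than a constant do not decrease dimension. -/
theorem dimH_le_dimH_image {f : ℝ → ℝ} {S : Set ℝ} {c : ℝ} (hc : 0 < c)
    (hf : ∀ x ∈ S, ∀ y ∈ S, c * |x - y| ≤ |f x - f y|) : dimH S ≤ dimH (f '' S) := by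
  have hanti : AntilipschitzWith (Real.toNNReal c⁻¹) (fun x : S => f x) := by
    refine AntilipschitzWith.of_le_mul_dist fun x y => ?_
    rw [Real.coe_toNNReal _ (inv_nonneg.2 hc.le), inv_mul_eq_div, le_div_iff₀ hc, mul_comm]
    exact hf x x.2 y y.2
  have h := hanti.le_dimH_image univ
  have h1 : dimH (univ : Set S) = dimH S := by
    rw [← (isometry_subtype_coe (s := S)).dimH_image univ]; simp
  rwa [h1, image_univ, ← image_eq_range] at h

/-! ### Systems of Möbius type: cylinders, distortion and length sums. -/

/-- `f x - f y = (x - y) * m x * m y` on the unit interval, for some positive multiplier `m` with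
`M`-Lipschitz logarithm and with `m x * m y ∈ [lam, ρ]`; Möbius maps have this property. -/
def HasMoebiusMultiplier (f : ℝ → ℝ) (ρ lam M : ℝ) : Prop :=
  ∃ m : ℝ → ℝ, (∀ x ∈ Icc (0 : ℝ) 1, 0 < m x) ∧
    (∀ x ∈ Icc (0 : ℝ) 1, ∀ y ∈ Icc (0 : ℝ) 1, f x - f y = (x - y) * (m x * m y)) ∧
    (∀ x ∈ Icc (0 : ℝ) 1, ∀ y ∈ Icc (0 : ℝ) 1, m x ≤ Real.exp (M * |x - y|) * m y) ∧
    (∀ x ∈ Icc (0 : ℝ) 1, ∀ y ∈ Icc (0 : ℝ) 1, m x * m y ≤ ρ ∧ lam ≤ m x * m y)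

/-- A family of contracting inverse branches `B j i` (letter `j`, symbol `i`) of the unit interval,
of Möbius type; the images of the branches of one letter are separated. -/
structure IsMoebiusSystem (B : Fin 2 → Fin 2 → ℝ → ℝ) (ρ lam M δ : ℝ) : Prop where
  rho_nonneg : 0 ≤ ρ
  rho_lt_one : ρ < 1
  lam_pos : 0 < lam
  lam_le_one : lam ≤ 1
  M_nonneg : 0 ≤ M
  sep_pos : 0 < δ
  mapsTo : ∀ j i, MapsTo (B j i) (Icc 0 1) (Icc 0 1)
  measurable : ∀ j i, Measurable (B j i)
  exists_multiplier : ∀ j i, HasMoebiusMultiplier (B j i) ρ lam M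
  sep : ∀ j i i', i ≠ i' → ∀ x ∈ Icc (0 : ℝ) 1, ∀ y ∈ Icc (0 : ℝ) 1, δ ≤ |B j i x - B j i' y|

/-- The composition `B (c 0) (w 0) ∘ ⋯ ∘ B (c (n - 1)) (w (n - 1))`. -/
def branch (B : Fin 2 → Fin 2 → ℝ → ℝ) : (c : ℕ → Fin 2) → (n : ℕ) → (Fin n → Fin 2) → ℝ → ℝ
  | _, 0, _ => id
  | c, n + 1, w => B (c 0) (w 0) ∘ branch B (fun k => c (k + 1)) n (Fin.tail w)

/-- The union of the cylinders of level `n`. -/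
def levelSet (B : Fin 2 → Fin 2 → ℝ → ℝ) (c : ℕ → Fin 2) (n : ℕ) : Set ℝ :=
  ⋃ w : Fin n → Fin 2, branch B c n w '' Icc 0 1

/-- The limit set of the branches along the sequence of letters `c`. -/
def limitSet (B : Fin 2 → Fin 2 → ℝ → ℝ) (c : ℕ → Fin 2) : Set ℝ :=
  ⋂ n, levelSet B c n

/-- The sum of the `s`-th powers of the lengths of the cylinders of level `n`. -/
noncomputable def lengthSum (B : Fin 2 → Fin 2 → ℝ → ℝ) (c : ℕ → Fin 2) (n : ℕ) (s : ℝ) : ℝ :=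
  ∑ w : Fin n → Fin 2, (branch B c n w 1 - branch B c n w 0) ^ s

theorem branch_congr (B : Fin 2 → Fin 2 → ℝ → ℝ) {c c' : ℕ → Fin 2} {n : ℕ}
    (h : ∀ k < n, c k = c' k) (w : Fin n → Fin 2) : branch B c n w = branch B c' n w := by
  induction n generalizing c c' with
  | zero => rfl
  | succ n ih =>
    rw [branch, branch, h 0 n.succ_pos, ih fun k hk => h (k + 1) (Nat.succ_lt_succ hk)]

theorem lengthSum_congr (B : Fin 2 → Fin 2 → ℝ → ℝ) {c c' : ℕ → Fin 2} {n : ℕ}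
    (h : ∀ k < n, c k = c' k) (s : ℝ) : lengthSum B c n s = lengthSum B c' n s := by
  simp only [lengthSum, branch_congr B h]

theorem sum_branch_succ (B : Fin 2 → Fin 2 → ℝ → ℝ) (c : ℕ → Fin 2) (n : ℕ)
    (g : (ℝ → ℝ) → ℝ) : ∑ w : Fin (n + 1) → Fin 2, g (branch B c (n + 1) w) =
      ∑ i, ∑ w : Fin n → Fin 2, g (B (c 0) i ∘ branch B (fun k => c (k + 1)) n w) := by
  rw [← Fintype.sum_prod_type', ← (Fin.consEquiv fun _ => Fin 2).sum_comp]
  exact Finset.sum_congr rfl fun p _ => by simp [branch, Fin.consEquiv]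

/-- Quantifying over all functionals `g` of the composed map lets the induction absorb the outermost
branch into `g`; a separate `N` avoids casts between `Fin` types. -/
theorem sum_branch_add (B : Fin 2 → Fin 2 → ℝ → ℝ) (c : ℕ → Fin 2) (m n N : ℕ) (hN : N = m + n)
    (g : (ℝ → ℝ) → ℝ) : ∑ w : Fin N → Fin 2, g (branch B c N w) =
      ∑ u : Fin m → Fin 2, ∑ v : Fin n → Fin 2,
        g (branch B c m u ∘ branch B (fun k => c (k + m)) n v) := by
  induction m generalizing c N g with
  | zero =>
    obtain rfl : N = n := by omega
    simp [branch]
  | succ m ih =>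
    obtain ⟨N', rfl⟩ : ∃ N', N = N' + 1 := ⟨m + n, by omega⟩
    rw [sum_branch_succ, sum_branch_succ B c m fun h =>
      ∑ v : Fin n → Fin 2, g (h ∘ branch B (fun k => c (k + (m + 1))) n v)]
    refine Finset.sum_congr rfl fun i _ => ?_
    exact ih (fun k => c (k + 1)) N' (by omega) fun h => g (B (c 0) i ∘ h)

theorem mem_levelSet_succ {B : Fin 2 → Fin 2 → ℝ → ℝ} {c : ℕ → Fin 2} {n : ℕ} {x : ℝ} :
    x ∈ levelSet B c (n + 1) ↔ ∃ i, ∃ y ∈ levelSet B (fun k => c (k + 1)) n, B (c 0) i y = x := by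
  simp only [levelSet, mem_iUnion, mem_image]
  constructor
  · rintro ⟨w, x, hx, rfl⟩
    exact ⟨w 0, _, ⟨Fin.tail w, x, hx, rfl⟩, rfl⟩
  · rintro ⟨i, _, ⟨w, x, hx, rfl⟩, rfl⟩
    exact ⟨Fin.cons i w, x, hx, by simp [branch]⟩

theorem levelSet_zero (B : Fin 2 → Fin 2 → ℝ → ℝ) (c : ℕ → Fin 2) :
    levelSet B c 0 = Icc 0 1 := by
  simp [levelSet, branch, iUnion_const]

theorem branch_mem_levelSet {B : Fin 2 → Fin 2 → ℝ → ℝ} {c : ℕ → Fin 2} {d m : ℕ}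
    (u : Fin d → Fin 2) {y : ℝ} (hy : y ∈ levelSet B (fun k => c (k + d)) m) :
    branch B c d u y ∈ levelSet B c (m + d) := by
  induction d generalizing c with
  | zero => exact hy
  | succ d ih =>
    exact mem_levelSet_succ.2 ⟨u 0, _, ih (c := fun k => c (k + 1)) (Fin.tail u) hy, rfl⟩

/-- The distortion constant of a system of Möbius type. -/
noncomputable def distortion (ρ M : ℝ) : ℝ := Real.exp (M / (1 - ρ)) ^ 2

namespace IsMoebiusSystem

variable {B : Fin 2 → Fin 2 → ℝ → ℝ} {ρ lam M δ : ℝ}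

theorem one_le_distortion (hB : IsMoebiusSystem B ρ lam M δ) : 1 ≤ distortion ρ M :=
  one_le_pow₀ (Real.one_le_exp (div_nonneg hB.M_nonneg (sub_nonneg.2 hB.rho_lt_one.le)))

theorem distortion_pos (hB : IsMoebiusSystem B ρ lam M δ) : 0 < distortion ρ M :=
  zero_lt_one.trans_le hB.one_le_distortion

theorem rho_pos (hB : IsMoebiusSystem B ρ lam M δ) : 0 < ρ := by
  obtain ⟨m, -, -, -, h⟩ := hB.exists_multiplier 0 0
  have h0 := h 0 (by simp) 0 (by simp)
  exact hB.lam_pos.trans_le (h0.2.trans h0.1)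

theorem branch_mapsTo (hB : IsMoebiusSystem B ρ lam M δ) (c : ℕ → Fin 2) (n : ℕ)
    (w : Fin n → Fin 2) : MapsTo (branch B c n w) (Icc 0 1) (Icc 0 1) := by
  induction n generalizing c with
  | zero => exact fun x hx => hx
  | succ n ih => exact (hB.mapsTo _ _).comp (ih _ _)

theorem measurable_branch (hB : IsMoebiusSystem B ρ lam M δ) (c : ℕ → Fin 2) (n : ℕ)
    (w : Fin n → Fin 2) : Measurable (branch B c n w) := by
  induction n generalizing c with
  | zero => exact measurable_id
  | succ n ih => exact (hB.measurable _ _).comp (ih _ _)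

theorem dist_le (hB : IsMoebiusSystem B ρ lam M δ) (j i : Fin 2) {x y : ℝ}
    (hx : x ∈ Icc (0 : ℝ) 1) (hy : y ∈ Icc (0 : ℝ) 1) : |B j i x - B j i y| ≤ ρ * |x - y| := by
  obtain ⟨m, hm, h1, -, h3⟩ := hB.exists_multiplier j i
  rw [h1 x hx y hy, abs_mul, abs_of_pos (mul_pos (hm x hx) (hm y hy)), mul_comm]
  gcongr
  exact (h3 x hx y hy).1

theorem le_dist (hB : IsMoebiusSystem B ρ lam M δ) (j i : Fin 2) {x y : ℝ}
    (hx : x ∈ Icc (0 : ℝ) 1) (hy : y ∈ Icc (0 : ℝ) 1) : lam * |x - y| ≤ |B j i x - B j i y| := by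
  obtain ⟨m, hm, h1, -, h3⟩ := hB.exists_multiplier j i
  rw [h1 x hx y hy, abs_mul, abs_of_pos (mul_pos (hm x hx) (hm y hy)), mul_comm]
  gcongr
  exact (h3 x hx y hy).2

theorem branch_dist_le_pow (hB : IsMoebiusSystem B ρ lam M δ) (c : ℕ → Fin 2) (n : ℕ)
    (w : Fin n → Fin 2) {x y : ℝ} (hx : x ∈ Icc (0 : ℝ) 1) (hy : y ∈ Icc (0 : ℝ) 1) :
    |branch B c n w x - branch B c n w y| ≤ ρ ^ n * |x - y| := by
  induction n generalizing c with
  | zero => simp [branch]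
  | succ n ih =>
    calc _ ≤ ρ * |branch B (fun k => c (k + 1)) n (Fin.tail w) x -
          branch B (fun k => c (k + 1)) n (Fin.tail w) y| :=
          hB.dist_le _ _ (hB.branch_mapsTo _ _ _ hx) (hB.branch_mapsTo _ _ _ hy)
      _ ≤ ρ * (ρ ^ n * |x - y|) := by
          have := hB.rho_nonneg
          gcongr
          exact ih _ _
      _ = _ := by ring

theorem branch_sep (hB : IsMoebiusSystem B ρ lam M δ) (c : ℕ → Fin 2) (n : ℕ)
    {w v : Fin n → Fin 2} (hwv : w ≠ v) {x y : ℝ} (hx : x ∈ Icc (0 : ℝ) 1)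
    (hy : y ∈ Icc (0 : ℝ) 1) : lam ^ n * δ ≤ |branch B c n w x - branch B c n v y| := by
  induction n generalizing c with
  | zero => exact absurd (Subsingleton.elim w v) hwv
  | succ n ih =>
    have hx' := hB.branch_mapsTo (fun k => c (k + 1)) n (Fin.tail w) hx
    have hy' := hB.branch_mapsTo (fun k => c (k + 1)) n (Fin.tail v) hy
    by_cases h0 : w 0 = v 0
    · have ht : Fin.tail w ≠ Fin.tail v := fun ht => hwv (by
        rw [← Fin.cons_self_tail w, ← Fin.cons_self_tail v, h0, ht])
      calc lam ^ (n + 1) * δ = lam * (lam ^ n * δ) := by ring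
        _ ≤ lam * |branch B (fun k => c (k + 1)) n (Fin.tail w) x -
              branch B (fun k => c (k + 1)) n (Fin.tail v) y| := by
            have := hB.lam_pos
            gcongr
            exact ih _ ht
        _ ≤ _ := by
            rw [branch, branch, h0]
            exact hB.le_dist _ _ hx' hy'
    · calc lam ^ (n + 1) * δ ≤ δ :=
            mul_le_of_le_one_left hB.sep_pos.le (pow_le_one₀ hB.lam_pos.le hB.lam_le_one)
        _ ≤ _ := hB.sep _ _ _ h0 _ hx' _ hy'

/-- Multipliers compose by a chain rule, `m' (h x) * m x`. The inner map `h` of level `n` contracts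
by `ρ ^ n`, so a new outer branch adds only `M * ρ ^ n` to the Lipschitz constant of the logarithm,
and the constants stay below a geometric series. -/
theorem exists_branch_multiplier (hB : IsMoebiusSystem B ρ lam M δ) (c : ℕ → Fin 2) (n : ℕ)
    (w : Fin n → Fin 2) : ∃ m : ℝ → ℝ, (∀ x ∈ Icc (0 : ℝ) 1, 0 < m x) ∧
      (∀ x ∈ Icc (0 : ℝ) 1, ∀ y ∈ Icc (0 : ℝ) 1,
        branch B c n w x - branch B c n w y = (x - y) * (m x * m y)) ∧
      (∀ x ∈ Icc (0 : ℝ) 1, ∀ y ∈ Icc (0 : ℝ) 1,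
        m x ≤ Real.exp (M * (∑ k ∈ Finset.range n, ρ ^ k) * |x - y|) * m y) := by
  induction n generalizing c with
  | zero => exact ⟨fun _ => 1, by simp, by simp [branch], by simp⟩
  | succ n ih =>
    obtain ⟨m, hm, h1, h2⟩ := ih (fun k => c (k + 1)) (Fin.tail w)
    obtain ⟨m', hm', h1', h2', -⟩ := hB.exists_multiplier (c 0) (w 0)
    set h := branch B (fun k => c (k + 1)) n (Fin.tail w)
    have hI : MapsTo h (Icc 0 1) (Icc 0 1) := hB.branch_mapsTo _ _ _
    refine ⟨fun x => m' (h x) * m x, fun x hx => mul_pos (hm' _ (hI hx)) (hm x hx), ?_, ?_⟩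
    · intro x hx y hy
      change B (c 0) (w 0) (h x) - B (c 0) (w 0) (h y) = _
      rw [h1' _ (hI hx) _ (hI hy), h1 x hx y hy]
      ring
    · intro x hx y hy
      have hexp : Real.exp (M * |h x - h y|) ≤ Real.exp (M * (ρ ^ n * |x - y|)) := by
        have := hB.M_nonneg
        gcongr
        exact hB.branch_dist_le_pow _ _ _ hx hy
      calc m' (h x) * m x ≤ (Real.exp (M * |h x - h y|) * m' (h y)) *
            (Real.exp (M * (∑ k ∈ Finset.range n, ρ ^ k) * |x - y|) * m y) :=
            mul_le_mul (h2' _ (hI hx) _ (hI hy)) (h2 x hx y hy) (hm x hx).le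
              (mul_nonneg (Real.exp_pos _).le (hm' _ (hI hy)).le)
        _ ≤ (Real.exp (M * (ρ ^ n * |x - y|)) * m' (h y)) *
            (Real.exp (M * (∑ k ∈ Finset.range n, ρ ^ k) * |x - y|) * m y) := by
            have := hm y hy
            have := hm' _ (hI hy)
            gcongr
        _ = _ := by
            rw [Finset.sum_range_succ,
              show M * (∑ k ∈ Finset.range n, ρ ^ k + ρ ^ n) * |x - y| =
                M * (ρ ^ n * |x - y|) + M * (∑ k ∈ Finset.range n, ρ ^ k) * |x - y| by ring,
              Real.exp_add]
            ring

theorem exists_bounded_multiplier (hB : IsMoebiusSystem B ρ lam M δ) (c : ℕ → Fin 2) (n : ℕ)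
    (w : Fin n → Fin 2) : ∃ m : ℝ → ℝ, (∀ x ∈ Icc (0 : ℝ) 1, 0 < m x) ∧
      (∀ x ∈ Icc (0 : ℝ) 1, ∀ y ∈ Icc (0 : ℝ) 1,
        branch B c n w x - branch B c n w y = (x - y) * (m x * m y)) ∧
      (∀ x ∈ Icc (0 : ℝ) 1, ∀ y ∈ Icc (0 : ℝ) 1, m x ≤ Real.exp (M / (1 - ρ)) * m y) := by
  obtain ⟨m, hm, h1, h2⟩ := hB.exists_branch_multiplier c n w
  refine ⟨m, hm, h1, fun x hx y hy => (h2 x hx y hy).trans ?_⟩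
  have h3 : ∑ k ∈ Finset.range n, ρ ^ k ≤ (1 - ρ)⁻¹ := by
    rw [← tsum_geometric_of_lt_one hB.rho_nonneg hB.rho_lt_one]
    exact (summable_geometric_of_lt_one hB.rho_nonneg hB.rho_lt_one).sum_le_tsum _
      fun k _ => pow_nonneg hB.rho_nonneg k
  have h4 : |x - y| ≤ 1 := abs_le.2 ⟨by linarith [hx.1, hy.2], by linarith [hx.2, hy.1]⟩
  have h5 : M * (∑ k ∈ Finset.range n, ρ ^ k) * |x - y| ≤ M / (1 - ρ) := by
    calc _ ≤ M * (∑ k ∈ Finset.range n, ρ ^ k) * 1 := by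
          have := hB.M_nonneg
          have : 0 ≤ ∑ k ∈ Finset.range n, ρ ^ k :=
            Finset.sum_nonneg fun k _ => pow_nonneg hB.rho_nonneg k
          gcongr
      _ ≤ _ := by
          rw [mul_one, div_eq_mul_inv]
          exact mul_le_mul_of_nonneg_left h3 hB.M_nonneg
  have := hm y hy
  gcongr

theorem length_pos (hB : IsMoebiusSystem B ρ lam M δ) (c : ℕ → Fin 2) (n : ℕ)
    (w : Fin n → Fin 2) : 0 < branch B c n w 1 - branch B c n w 0 := by
  obtain ⟨m, hm, h1, -⟩ := hB.exists_bounded_multiplier c n w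
  rw [h1 1 (by simp) 0 (by simp)]
  have := hm 1 (by simp)
  have := hm 0 (by simp)
  simp only [sub_zero, one_mul]
  positivity

theorem length_le_pow (hB : IsMoebiusSystem B ρ lam M δ) (c : ℕ → Fin 2) (n : ℕ)
    (w : Fin n → Fin 2) : branch B c n w 1 - branch B c n w 0 ≤ ρ ^ n := by
  have h := hB.branch_dist_le_pow c n w (x := 1) (y := 0) (by simp) (by simp)
  simp only [sub_zero, abs_one, mul_one] at h
  exact (le_abs_self _).trans h

/-- Compare `m x * m y` with `m 1 * m 0`, which is the length of the cylinder. Each of the two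
factors costs `exp (M / (1 - ρ))`, whence the square in `distortion`. -/
theorem branch_dist_le (hB : IsMoebiusSystem B ρ lam M δ) (c : ℕ → Fin 2) (n : ℕ)
    (w : Fin n → Fin 2) {x y : ℝ} (hx : x ∈ Icc (0 : ℝ) 1) (hy : y ∈ Icc (0 : ℝ) 1) :
    |branch B c n w x - branch B c n w y| ≤
      distortion ρ M * (branch B c n w 1 - branch B c n w 0) * |x - y| := by
  obtain ⟨m, hm, h1, h2⟩ := hB.exists_bounded_multiplier c n w
  have hx0 := hm x hx
  have hy0 := hm y hy
  rw [h1 x hx y hy, h1 1 (by simp) 0 (by simp), abs_mul, abs_of_pos (mul_pos hx0 hy0), mul_comm]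
  refine mul_le_mul_of_nonneg_right ?_ (abs_nonneg _)
  calc m x * m y ≤ (Real.exp (M / (1 - ρ)) * m 1) * (Real.exp (M / (1 - ρ)) * m 0) :=
        mul_le_mul (h2 x hx 1 (by simp)) (h2 y hy 0 (by simp)) hy0.le
          (hx0.le.trans (h2 x hx 1 (by simp)))
    _ = _ := by rw [distortion]; ring

theorem le_branch_dist (hB : IsMoebiusSystem B ρ lam M δ) (c : ℕ → Fin 2) (n : ℕ)
    (w : Fin n → Fin 2) {x y : ℝ} (hx : x ∈ Icc (0 : ℝ) 1) (hy : y ∈ Icc (0 : ℝ) 1) :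
    (branch B c n w 1 - branch B c n w 0) / distortion ρ M * |x - y| ≤
      |branch B c n w x - branch B c n w y| := by
  obtain ⟨m, hm, h1, h2⟩ := hB.exists_bounded_multiplier c n w
  have hx0 := hm x hx
  have hy0 := hm y hy
  have h00 := hm 0 (by simp)
  have h11 := hm 1 (by simp)
  rw [h1 x hx y hy, h1 1 (by simp) 0 (by simp), abs_mul, abs_of_pos (mul_pos hx0 hy0),
    mul_comm |x - y|]
  gcongr
  rw [div_le_iff₀ hB.distortion_pos, distortion]
  calc (1 - 0) * (m 1 * m 0) = m 1 * m 0 := by ring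
    _ ≤ (Real.exp (M / (1 - ρ)) * m x) * (Real.exp (M / (1 - ρ)) * m y) :=
        mul_le_mul (h2 1 (by simp) x hx) (h2 0 (by simp) y hy) h00.le
          (h11.le.trans (h2 1 (by simp) x hx))
    _ = _ := by ring

theorem lengthSum_nonneg (hB : IsMoebiusSystem B ρ lam M δ) (c : ℕ → Fin 2) (n : ℕ) (s : ℝ) :
    0 ≤ lengthSum B c n s :=
  Finset.sum_nonneg fun w _ => Real.rpow_nonneg (hB.length_pos c n w).le _

theorem lengthSum_zero (B : Fin 2 → Fin 2 → ℝ → ℝ) (c : ℕ → Fin 2) (s : ℝ) :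
    lengthSum B c 0 s = 1 := by
  simp [lengthSum, branch]

theorem lengthSum_le_two_pow (hB : IsMoebiusSystem B ρ lam M δ) (c : ℕ → Fin 2) (n : ℕ) {s : ℝ}
    (hs : 0 ≤ s) : lengthSum B c n s ≤ 2 ^ n := by
  calc lengthSum B c n s ≤ ∑ w : Fin n → Fin 2, (1 : ℝ) :=
        Finset.sum_le_sum fun w _ => Real.rpow_le_one (hB.length_pos c n w).le
          ((hB.length_le_pow c n w).trans (pow_le_one₀ hB.rho_nonneg hB.rho_lt_one.le)) hs
    _ = 2 ^ n := by simp

/-- Bounded distortion of the outer `m` letters, applied to the endpoints of each inner cylinder. -/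
theorem lengthSum_add_le (hB : IsMoebiusSystem B ρ lam M δ) (c : ℕ → Fin 2) (m n : ℕ) {s : ℝ}
    (hs : 0 ≤ s) : lengthSum B c (m + n) s ≤
      distortion ρ M ^ s * (lengthSum B c m s * lengthSum B (fun k => c (k + m)) n s) := by
  have hK := hB.distortion_pos
  rw [lengthSum, sum_branch_add B c m n _ rfl fun h => (h 1 - h 0) ^ s, lengthSum, lengthSum,
    Finset.sum_mul_sum, Finset.mul_sum]
  refine Finset.sum_le_sum fun u _ => ?_
  rw [Finset.mul_sum]
  refine Finset.sum_le_sum fun v _ => ?_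
  set h₂ := branch B (fun k => c (k + m)) n v
  have hl1 := hB.length_pos c m u
  have hl2 : 0 < h₂ 1 - h₂ 0 := hB.length_pos (fun k => c (k + m)) n v
  have h1 : h₂ 1 ∈ Icc (0 : ℝ) 1 := hB.branch_mapsTo _ _ _ (by simp)
  have h0 : h₂ 0 ∈ Icc (0 : ℝ) 1 := hB.branch_mapsTo _ _ _ (by simp)
  rw [← Real.mul_rpow hl1.le hl2.le, ← Real.mul_rpow hK.le (by positivity), ← mul_assoc]
  have hd := hB.branch_dist_le c m u h1 h0
  obtain ⟨μ, hμ, hμ1, -⟩ := hB.exists_bounded_multiplier c m u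
  have hpos : 0 ≤ branch B c m u (h₂ 1) - branch B c m u (h₂ 0) := by
    rw [hμ1 _ h1 _ h0]
    have := hμ _ h1
    have := hμ _ h0
    positivity
  rw [abs_of_nonneg hpos, abs_of_pos hl2] at hd
  exact Real.rpow_le_rpow hpos hd hs

theorem lengthSum_le_pow_mul (hB : IsMoebiusSystem B ρ lam M δ) (c : ℕ → Fin 2) (n : ℕ)
    {s s' : ℝ} (hs : s ≤ s') :
    lengthSum B c n s' ≤ (ρ ^ n) ^ (s' - s) * lengthSum B c n s := by
  rw [lengthSum, lengthSum, Finset.mul_sum]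
  refine Finset.sum_le_sum fun w _ => ?_
  have hl := hB.length_pos c n w
  have hle := hB.length_le_pow c n w
  rw [show s' = (s' - s) + s by ring, Real.rpow_add hl, add_sub_cancel_right]
  gcongr

theorem levelSet_antitone (hB : IsMoebiusSystem B ρ lam M δ) (c : ℕ → Fin 2) :
    Antitone (levelSet B c) := by
  refine antitone_nat_of_succ_le fun n => ?_
  induction n generalizing c with
  | zero =>
    intro x hx
    obtain ⟨i, y, hy, rfl⟩ := mem_levelSet_succ.1 hx
    rw [levelSet_zero] at hy ⊢
    exact hB.mapsTo _ _ hy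
  | succ n ih =>
    intro x hx
    obtain ⟨i, y, hy, rfl⟩ := mem_levelSet_succ.1 hx
    exact mem_levelSet_succ.2 ⟨i, y, ih _ hy, rfl⟩

theorem dimH_limitSet_le (hB : IsMoebiusSystem B ρ lam M δ) (c : ℕ → Fin 2) {s : ℝ≥0} {A : ℝ}
    (hA : ∃ᶠ n in atTop, lengthSum B c n s ≤ A) : dimH (limitSet B c) ≤ s := by
  have hK := hB.distortion_pos
  refine dimH_le_of_frequently_covers (κ := fun n => Fin n → Fin 2)
    (fun n w => branch B c n w '' Icc 0 1) (fun n x hx => mem_iInter.1 hx n)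
    (fun n w => distortion ρ M * (branch B c n w 1 - branch B c n w 0))
    (ε := fun n => distortion ρ M * ρ ^ n) ?_ (fun n w => ?_) (fun n w => ?_) (fun n w => ?_)
    (M := distortion ρ M ^ (s : ℝ) * A) (hA.mono fun n hn => ?_)
  · simpa using (tendsto_pow_atTop_nhds_zero_of_lt_one hB.rho_nonneg hB.rho_lt_one).const_mul
      (distortion ρ M)
  · gcongr
    exact hB.length_le_pow c n w
  · exact mul_nonneg hK.le (hB.length_pos c n w).le
  · rintro _ ⟨x, hx, rfl⟩ _ ⟨y, hy, rfl⟩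
    refine (hB.branch_dist_le c n w hx hy).trans (mul_le_of_le_one_right
      (mul_nonneg hK.le (hB.length_pos c n w).le) ?_)
    exact abs_le.2 ⟨by linarith [hx.1, hy.2], by linarith [hx.2, hy.1]⟩
  · simp only [Real.mul_rpow hK.le (hB.length_pos c n _).le, ← Finset.mul_sum]
    gcongr
    exact hn

/-- Each group of `d k` letters becomes one step of a nonautonomous system, with lower ratios equal
to cylinder lengths divided by the distortion; this is why the sums must reach `distortion ρ M ^ s`.
The bound `D` on the group lengths makes the separation `lam ^ D * δ` uniform. -/
theorem le_dimH_limitSet_of_blocks (hB : IsMoebiusSystem B ρ lam M δ) (c : ℕ → Fin 2)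
    {t d : ℕ → ℕ} (ht0 : t 0 = 0) (ht : ∀ k, t (k + 1) = t k + d k) (hd : ∀ k, 1 ≤ d k) {D : ℕ}
    (hD : ∀ k, d k ≤ D) {s : ℝ≥0}
    (hs : ∀ k, distortion ρ M ^ (s : ℝ) ≤ lengthSum B (fun i => c (i + t k)) (d k) s) :
    (s : ℝ≥0∞) ≤ dimH (limitSet B c) := by
  have hK := hB.distortion_pos
  have htk : ∀ k, k ≤ t k := fun k => by
    induction k with
    | zero => exact Nat.zero_le _
    | succ k ih => rw [ht]; have := hd k; omega
  refine (le_dimH_of_lower_ratios (ι := fun k => Fin (d k) → Fin 2)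
    (φ := fun k w => branch B (fun i => c (i + t k)) (d k) w)
    (fun k w => hB.branch_mapsTo _ _ _) (fun k w => hB.measurable_branch _ _ _) hB.rho_lt_one
    (fun k w x hx y hy => ?_)
    (c := fun k w => (branch B (fun i => c (i + t k)) (d k) w 1 -
      branch B (fun i => c (i + t k)) (d k) w 0) / distortion ρ M)
    (fun k w => div_pos (hB.length_pos _ _ _) hK)
    (fun k w x hx y hy => hB.le_branch_dist _ _ _ hx hy)
    (δ := lam ^ D * δ) (mul_pos (pow_pos hB.lam_pos _) hB.sep_pos)
    (fun k w v hwv x hx y hy => ?_) (fun k => ?_)).trans (dimH_mono ?_)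
  · refine (hB.branch_dist_le_pow _ _ _ hx hy).trans ?_
    gcongr
    exact pow_le_of_le_one hB.rho_nonneg hB.rho_lt_one.le (Nat.one_le_iff_ne_zero.1 (hd k))
  · refine le_trans ?_ (hB.branch_sep _ _ hwv hx hy)
    exact mul_le_mul_of_nonneg_right (pow_le_pow_of_le_one hB.lam_pos.le hB.lam_le_one (hD k))
      hB.sep_pos.le
  · simp only [Real.div_rpow (hB.length_pos _ _ _).le hK.le, ← Finset.sum_div]
    rw [le_div_iff₀ (Real.rpow_pos_of_pos hK _), one_mul]
    exact hs k
  · rintro x ⟨w, hw⟩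
    -- The additional depth `m` is needed because `nestedComp` grows from the inside.
    have key : ∀ n m, ∀ y ∈ levelSet B (fun i => c (i + t n)) m,
        nestedComp (fun k w => branch B (fun i => c (i + t k)) (d k) w) w n y ∈
          levelSet B c (m + t n) := by
      intro n
      induction n with
      | zero => intro m y hy; simpa [ht0, nestedComp] using hy
      | succ n ih =>
        intro m y hy
        have h := ih (m + d n) _ (branch_mem_levelSet (c := fun i => c (i + t n)) (w n) (y := y)
          (m := m) (by
            have : (fun k => c (k + d n + t n)) = fun i => c (i + t (n + 1)) := by
              funext k; rw [ht, add_assoc, add_comm (d n)]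
            rw [this]; exact hy))
        rw [ht, add_comm (t n), ← add_assoc]
        exact h
    refine mem_iInter.2 fun n => hB.levelSet_antitone c (htk n) ?_
    obtain ⟨y, hy, rfl⟩ := hw n
    have h := key n 0 y (by rwa [levelSet_zero])
    rwa [zero_add] at h

/-- A single inverse branch embeds the limit set of the shifted sequence into the original one,
contracting distances by no more than the factor `lam`. -/
theorem dimH_limitSet_shift_le (hB : IsMoebiusSystem B ρ lam M δ) (c : ℕ → Fin 2) (k : ℕ) :
    dimH (limitSet B fun i => c (i + k)) ≤ dimH (limitSet B c) := by
  induction k generalizing c with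
  | zero => exact le_rfl
  | succ k ih =>
    refine (ih fun i => c (i + 1)).trans ?_
    have hI : ∀ x ∈ limitSet B (fun i => c (i + 1)), x ∈ Icc (0 : ℝ) 1 := fun x hx => by
      have := mem_iInter.1 hx 0
      rwa [levelSet_zero] at this
    refine (dimH_le_dimH_image (f := B (c 0) 0) hB.lam_pos
      fun x hx y hy => hB.le_dist _ _ (hI x hx) (hI y hy)).trans (dimH_mono ?_)
    rintro _ ⟨x, hx, rfl⟩
    refine mem_iInter.2 fun n => hB.levelSet_antitone c n.le_succ ?_
    exact mem_levelSet_succ.2 ⟨0, x, mem_iInter.1 hx n, rfl⟩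

/-! ### Periodic sequences: the dimension as a threshold for length sums. -/

section Periodic

variable {c : ℕ → Fin 2} {p : ℕ} {s : ℝ≥0}

theorem shift_mul_of_periodic (hc : ∀ k, c (k + p) = c k) (n : ℕ) :
    (fun k => c (k + p * n)) = c := by
  induction n with
  | zero => rfl
  | succ n ih => funext k; rw [mul_add, mul_one, ← add_assoc, hc]; exact congrFun ih k

/-- Otherwise submultiplicativity would keep the sums at all multiples of `p * n` below `1`, and the
covers by cylinders would give dimension at most `s`. -/
theorem one_le_lengthSum_of_lt_dimH (hB : IsMoebiusSystem B ρ lam M δ) (hp : 0 < p)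
    (hc : ∀ k, c (k + p) = c k) (hs : (s : ℝ≥0∞) < dimH (limitSet B c)) (n : ℕ) :
    1 ≤ distortion ρ M ^ (s : ℝ) * lengthSum B c (p * n) s := by
  by_contra! hlt
  have hKs : 1 ≤ distortion ρ M ^ (s : ℝ) := Real.one_le_rpow hB.one_le_distortion s.coe_nonneg
  have hK0 : 0 < distortion ρ M ^ (s : ℝ) := by linarith
  have hn : 0 < n := by
    rcases n.eq_zero_or_pos with rfl | h
    · rw [mul_zero, lengthSum_zero, mul_one] at hlt
      linarith
    · exact h
  have hpow : ∀ k, lengthSum B c (p * n * k) s ≤ 1 := by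
    intro k
    induction k with
    | zero => rw [mul_zero, lengthSum_zero]
    | succ k ih =>
      have h := hB.lengthSum_add_le c (p * n) (p * n * k) s.coe_nonneg
      rw [shift_mul_of_periodic hc, ← mul_assoc] at h
      rw [mul_add, mul_one, add_comm]
      exact h.trans (mul_le_one₀ hlt.le (hB.lengthSum_nonneg _ _ _) ih)
  refine hs.not_ge (hB.dimH_limitSet_le c (A := 1) ?_)
  refine frequently_atTop.2 fun a => ⟨p * n * a, Nat.le_mul_of_pos_left a (by positivity), hpow a⟩

/-- Otherwise groups of `p * n` letters would satisfy the mass distribution criterion with exponent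
`s`. -/
theorem lengthSum_le_of_dimH_lt (hB : IsMoebiusSystem B ρ lam M δ) (hp : 0 < p)
    (hc : ∀ k, c (k + p) = c k) (hs : dimH (limitSet B c) < s) (n : ℕ) :
    lengthSum B c (p * n) s ≤ distortion ρ M ^ (s : ℝ) := by
  rcases n.eq_zero_or_pos with rfl | hn
  · rw [mul_zero, lengthSum_zero]
    exact Real.one_le_rpow hB.one_le_distortion s.coe_nonneg
  · by_contra! hlt
    refine hs.not_ge (hB.le_dimH_limitSet_of_blocks c (t := fun k => p * (n * k))
      (d := fun _ => p * n) (by simp) (fun k => by ring) (fun _ => Nat.mul_pos hp hn)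
      (D := p * n) (fun _ => le_rfl) fun k => ?_)
    rw [shift_mul_of_periodic hc]
    exact hlt.le

/-- At an exponent `s'` strictly between `s` and the dimension the sums are bounded below; passing
down to `s` multiplies them by at least `ρ ^ (-(p * n) * (s' - s))`, which tends to infinity. -/
theorem eventually_le_lengthSum (hB : IsMoebiusSystem B ρ lam M δ) (hp : 0 < p)
    (hc : ∀ k, c (k + p) = c k) (hs : (s : ℝ≥0∞) < dimH (limitSet B c)) (A : ℝ) :
    ∀ᶠ n in atTop, A ≤ lengthSum B c (p * n) s := by
  obtain ⟨s', hss', hs'⟩ := ENNReal.lt_iff_exists_nnreal_btwn.1 hs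
  have hlt : (0 : ℝ) < s' - s := sub_pos.2 (by exact_mod_cast hss')
  set r : ℝ := ρ ^ ((s' : ℝ) - s)
  have hr0 : 0 ≤ r := Real.rpow_nonneg hB.rho_nonneg _
  have hr1 : r < 1 := Real.rpow_lt_one hB.rho_nonneg hB.rho_lt_one hlt
  have hK0 : 0 < distortion ρ M ^ (s' : ℝ) := Real.rpow_pos_of_pos hB.distortion_pos _
  have hlim : Tendsto (fun n : ℕ => distortion ρ M ^ (s' : ℝ) * r ^ n * A) atTop (𝓝 0) := by
    simpa using ((tendsto_pow_atTop_nhds_zero_of_lt_one hr0 hr1).const_mul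
      (distortion ρ M ^ (s' : ℝ))).mul_const A
  filter_upwards [hlim.eventually_le_const (zero_lt_one)] with n hn
  by_contra! hA
  have h1 := hB.one_le_lengthSum_of_lt_dimH hp hc hs' n
  have h2 := hB.lengthSum_le_pow_mul c (p * n) (s := s) (s' := s') (by linarith)
  have h3 : (ρ ^ (p * n)) ^ ((s' : ℝ) - s) ≤ r ^ n := by
    rw [← Real.rpow_natCast, ← Real.rpow_mul hB.rho_nonneg, mul_comm ((p * n : ℕ) : ℝ),
      Real.rpow_mul hB.rho_nonneg, Real.rpow_natCast]
    exact pow_le_pow_of_le_one hr0 hr1.le (Nat.le_mul_of_pos_left n hp)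
  have h0 := hB.lengthSum_nonneg c (p * n) s
  have hr : 0 < r := Real.rpow_pos_of_pos hB.rho_pos _
  have h4 : distortion ρ M ^ (s' : ℝ) * lengthSum B c (p * n) s' <
      distortion ρ M ^ (s' : ℝ) * r ^ n * A := by
    calc _ ≤ distortion ρ M ^ (s' : ℝ) * (r ^ n * lengthSum B c (p * n) s) := by
          gcongr
          refine h2.trans ?_; gcongr
      _ < distortion ρ M ^ (s' : ℝ) * (r ^ n * A) := by gcongr
      _ = _ := by ring
  linarith

/-- The mirror argument: the sums are bounded at an `s'` between the dimension and `s`, and raising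
the exponent to `s` gains a geometric factor. -/
theorem exists_lengthSum_le_geometric (hB : IsMoebiusSystem B ρ lam M δ) (hp : 0 < p)
    (hc : ∀ k, c (k + p) = c k) (hs : dimH (limitSet B c) < s) :
    ∃ A r : ℝ, 0 ≤ A ∧ 0 ≤ r ∧ r < 1 ∧ ∀ n, lengthSum B c (p * n) s ≤ A * r ^ n := by
  obtain ⟨s', hs', hss'⟩ := ENNReal.lt_iff_exists_nnreal_btwn.1 hs
  have hlt : (0 : ℝ) < s - s' := sub_pos.2 (by exact_mod_cast hss')
  set r : ℝ := ρ ^ ((s : ℝ) - s')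
  have hr0 : 0 ≤ r := Real.rpow_nonneg hB.rho_nonneg _
  have hr1 : r < 1 := Real.rpow_lt_one hB.rho_nonneg hB.rho_lt_one hlt
  have hK0 : 0 < distortion ρ M ^ (s' : ℝ) := Real.rpow_pos_of_pos hB.distortion_pos _
  refine ⟨distortion ρ M ^ (s' : ℝ), r, hK0.le, hr0, hr1, fun n => ?_⟩
  have h1 := hB.lengthSum_le_of_dimH_lt hp hc hs' n
  have h2 := hB.lengthSum_le_pow_mul c (p * n) (s := s') (s' := s) (by linarith)
  have h3 : (ρ ^ (p * n)) ^ ((s : ℝ) - s') ≤ r ^ n := by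
    rw [← Real.rpow_natCast, ← Real.rpow_mul hB.rho_nonneg, mul_comm ((p * n : ℕ) : ℝ),
      Real.rpow_mul hB.rho_nonneg, Real.rpow_natCast]
    exact pow_le_pow_of_le_one hr0 hr1.le (Nat.le_mul_of_pos_left n hp)
  calc _ ≤ (ρ ^ (p * n)) ^ ((s : ℝ) - s') * lengthSum B c (p * n) s' := h2
    _ ≤ r ^ n * distortion ρ M ^ (s' : ℝ) :=
        mul_le_mul h3 h1 (hB.lengthSum_nonneg _ _ _) (pow_nonneg hr0 n)
    _ = _ := mul_comm _ _

end Periodic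

end IsMoebiusSystem

/-! ### The inverse branches of the example form a system of Möbius type. -/

/-- The inverse of the Möbius branch. -/
noncomputable def moebiusInverse (ε x : ℝ) : ℝ := x / ((1 + ε) + (19 - ε) * x)

/-- The inverse branches of `F₀` and `F₁`. -/
noncomputable def inverseBranch (ε : ℝ) : Fin 2 → Fin 2 → ℝ → ℝ :=
  ![![moebiusInverse ε, fun x => (x + 19) / 20],
    ![fun x => 1 - moebiusInverse ε (1 - x), fun x => 1 - (1 - x + 19) / 20]]

theorem one_sub_mem_unitInterval {x : ℝ} (hx : x ∈ Icc (0 : ℝ) 1) : 1 - x ∈ Icc (0 : ℝ) 1 :=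
  ⟨by linarith [hx.2], by linarith [hx.1]⟩

theorem inverseBranch_rev (ε : ℝ) (j i : Fin 2) (x : ℝ) :
    inverseBranch ε j.rev i x = 1 - inverseBranch ε j i (1 - x) := by
  fin_cases j <;> fin_cases i <;> simp [inverseBranch, Fin.rev]

theorem HasMoebiusMultiplier.reflect {f : ℝ → ℝ} {ρ lam M : ℝ}
    (h : HasMoebiusMultiplier f ρ lam M) :
    HasMoebiusMultiplier (fun x => 1 - f (1 - x)) ρ lam M := by
  obtain ⟨m, h0, h1, h2, h3⟩ := h
  have hr : ∀ {x : ℝ}, x ∈ Icc (0 : ℝ) 1 → 1 - x ∈ Icc (0 : ℝ) 1 := one_sub_mem_unitInterval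
  refine ⟨fun x => m (1 - x), fun x hx => h0 _ (hr hx), fun x hx y hy => ?_, fun x hx y hy => ?_,
    fun x hx y hy => h3 _ (hr hx) _ (hr hy)⟩
  · have := h1 _ (hr hx) _ (hr hy)
    linear_combination -this
  · have := h2 _ (hr hx) _ (hr hy)
    rwa [show 1 - x - (1 - y) = -(x - y) by ring, abs_neg] at this

/-- The denominator is affine in `x`, with values `1 + ε` at `0` and `20` at `1`. -/
theorem min_le_moebiusInverse_den {ε x : ℝ} (hx : x ∈ Icc (0 : ℝ) 1) :
    min (1 + ε) 20 ≤ (1 + ε) + (19 - ε) * x := by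
  have h1 := min_le_left (1 + ε) 20
  have h2 := min_le_right (1 + ε) 20
  nlinarith [mul_le_mul_of_nonneg_right h1 (sub_nonneg.2 hx.2),
    mul_le_mul_of_nonneg_right h2 hx.1]

theorem moebiusInverse_den_le_max {ε x : ℝ} (hx : x ∈ Icc (0 : ℝ) 1) :
    (1 + ε) + (19 - ε) * x ≤ max (1 + ε) 20 := by
  have h1 := le_max_left (1 + ε) 20
  have h2 := le_max_right (1 + ε) 20
  nlinarith [mul_le_mul_of_nonneg_right h1 (sub_nonneg.2 hx.2),
    mul_le_mul_of_nonneg_right h2 hx.1]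

theorem moebiusInverse_den_pos {ε x : ℝ} (hε : 0 < ε) (hx : x ∈ Icc (0 : ℝ) 1) :
    0 < (1 + ε) + (19 - ε) * x :=
  (lt_min (by linarith) (by norm_num)).trans_le (min_le_moebiusInverse_den hx)

theorem moebiusInverse_sub {ε x y : ℝ} (hε : 0 < ε) (hx : x ∈ Icc (0 : ℝ) 1)
    (hy : y ∈ Icc (0 : ℝ) 1) : moebiusInverse ε x - moebiusInverse ε y =
      (x - y) * ((1 + ε) / (((1 + ε) + (19 - ε) * x) * ((1 + ε) + (19 - ε) * y))) := by
  have h1 := (moebiusInverse_den_pos hε hx).ne'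
  have h2 := (moebiusInverse_den_pos hε hy).ne'
  rw [moebiusInverse, moebiusInverse, div_sub_div _ _ h1 h2, ← mul_div_assoc]
  congr 1
  ring

/-- The multiplier is `√(1 + ε)` over the denominator. The denominator is at least `1` with slope
`19 - ε`, so its values at two points have ratio at most `1 + M * |x - y|`, hence at most the
exponential. -/
theorem hasMoebiusMultiplier_moebiusInverse {ε ρ lam M : ℝ} (hε : 0 < ε)
    (hρ : (1 + ε) / min (1 + ε) 20 ^ 2 ≤ ρ) (hlam : lam ≤ (1 + ε) / max (1 + ε) 20 ^ 2)
    (hM : |19 - ε| ≤ M) : HasMoebiusMultiplier (moebiusInverse ε) ρ lam M := by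
  have hmin : 1 ≤ min (1 + ε) 20 := le_min (by linarith) (by norm_num)
  have hmul : ∀ x y : ℝ, √(1 + ε) / x * (√(1 + ε) / y) = (1 + ε) / (x * y) := fun x y => by
    rw [div_mul_div_comm, Real.mul_self_sqrt (by linarith)]
  refine ⟨fun x => √(1 + ε) / ((1 + ε) + (19 - ε) * x), fun x hx => ?_, fun x hx y hy => ?_,
    fun x hx y hy => ?_, fun x hx y hy => ?_⟩
  · exact div_pos (Real.sqrt_pos.2 (by linarith)) (moebiusInverse_den_pos hε hx)
  · rw [moebiusInverse_sub hε hx hy, hmul]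
  · have hx0 := moebiusInverse_den_pos hε hx
    have hy0 := moebiusInverse_den_pos hε hy
    have hx1 := hmin.trans (min_le_moebiusInverse_den hx)
    have h1 : (19 - ε) * (y - x) ≤ M * |x - y| := by
      calc _ ≤ |(19 - ε) * (y - x)| := le_abs_self _
        _ = |19 - ε| * |x - y| := by rw [abs_mul, abs_sub_comm y]
        _ ≤ _ := by gcongr
    have h2 : 0 ≤ M * |x - y| := mul_nonneg ((abs_nonneg _).trans hM) (abs_nonneg _)
    have h3 := Real.add_one_le_exp (M * |x - y|)
    have h4 : (1 + ε) + (19 - ε) * y ≤ Real.exp (M * |x - y|) * ((1 + ε) + (19 - ε) * x) := by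
      nlinarith [mul_le_mul_of_nonneg_right h3 hx0.le, mul_le_mul_of_nonneg_left hx1 h2]
    rw [← mul_div_assoc, div_le_div_iff₀ hx0 hy0]
    nlinarith [mul_le_mul_of_nonneg_left h4 (Real.sqrt_nonneg (1 + ε))]
  · have hx0 := moebiusInverse_den_pos hε hx
    have hy0 := moebiusInverse_den_pos hε hy
    have ha : 0 < 1 + ε := by linarith
    constructor
    · rw [hmul]
      refine le_trans (div_le_div_of_nonneg_left ha.le (by positivity) ?_) hρ
      rw [sq]
      exact mul_le_mul (min_le_moebiusInverse_den hx) (min_le_moebiusInverse_den hy)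
        (by linarith) hx0.le
    · rw [hmul]
      refine hlam.trans (div_le_div_of_nonneg_left ha.le (by positivity) ?_)
      rw [sq]
      exact mul_le_mul (moebiusInverse_den_le_max hx) (moebiusInverse_den_le_max hy)
        hy0.le (hx0.le.trans (moebiusInverse_den_le_max hx))

theorem hasMoebiusMultiplier_affine {ρ lam M : ℝ} (hρ : 1 / 20 ≤ ρ) (hlam : lam ≤ 1 / 20)
    (hM : 0 ≤ M) : HasMoebiusMultiplier (fun x => (x + 19) / 20) ρ lam M := by
  have h20 : √(1 / 20) * √(1 / 20) = (1 / 20 : ℝ) := Real.mul_self_sqrt (by norm_num)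
  refine ⟨fun _ => √(1 / 20), fun _ _ => by positivity, fun x _ y _ => ?_, fun x _ y _ => ?_,
    fun x _ y _ => ?_⟩
  · rw [h20]; ring
  · exact le_mul_of_one_le_left (Real.sqrt_nonneg _) (Real.one_le_exp (by positivity))
  · rw [h20]; exact ⟨hρ, hlam⟩

theorem moebiusInverse_mem {ε x : ℝ} (hε : 0 < ε) (hx : x ∈ Icc (0 : ℝ) 1) :
    moebiusInverse ε x ∈ Icc (0 : ℝ) (1 / 20) := by
  have h := moebiusInverse_den_pos hε hx
  refine ⟨div_nonneg hx.1 h.le, ?_⟩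
  rw [moebiusInverse, div_le_iff₀ h]
  nlinarith [hx.1, hx.2]

theorem inverseBranch_mapsTo {ε : ℝ} (hε : 0 < ε) (j i : Fin 2) :
    MapsTo (inverseBranch ε j i) (Icc 0 1) (Icc 0 1) := by
  have h0 : ∀ i, MapsTo (inverseBranch ε 0 i) (Icc 0 1) (Icc 0 1) := by
    intro i x hx
    fin_cases i
    · exact Icc_subset_Icc_right (by norm_num) (moebiusInverse_mem hε hx)
    · change (x + 19) / 20 ∈ Icc (0 : ℝ) 1
      constructor <;> linarith [hx.1, hx.2]
  intro x hx
  fin_cases j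
  · exact h0 i hx
  · change inverseBranch ε (Fin.rev 0) i x ∈ Icc (0 : ℝ) 1
    rw [inverseBranch_rev]
    exact one_sub_mem_unitInterval (h0 i (one_sub_mem_unitInterval hx))

theorem inverseBranch_sep {ε : ℝ} (hε : 0 < ε) (j : Fin 2) {i i' : Fin 2} (hi : i ≠ i') {x y : ℝ}
    (hx : x ∈ Icc (0 : ℝ) 1) (hy : y ∈ Icc (0 : ℝ) 1) :
    9 / 10 ≤ |inverseBranch ε j i x - inverseBranch ε j i' y| := by
  have h01 : ∀ x ∈ Icc (0 : ℝ) 1, ∀ y ∈ Icc (0 : ℝ) 1,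
      9 / 10 ≤ |inverseBranch ε 0 0 x - inverseBranch ε 0 1 y| := by
    intro x hx y hy
    have h := (moebiusInverse_mem hε hx).2
    rw [abs_sub_comm]
    refine le_trans ?_ (le_abs_self _)
    change 9 / 10 ≤ (y + 19) / 20 - moebiusInverse ε x
    linarith [hy.1]
  have h0 : ∀ x ∈ Icc (0 : ℝ) 1, ∀ y ∈ Icc (0 : ℝ) 1,
      9 / 10 ≤ |inverseBranch ε 0 i x - inverseBranch ε 0 i' y| := by
    intro x hx y hy
    fin_cases i <;> fin_cases i'
    · exact absurd rfl hi
    · exact h01 x hx y hy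
    · rw [abs_sub_comm]; exact h01 y hy x hx
    · exact absurd rfl hi
  fin_cases j
  · exact h0 x hx y hy
  · change 9 / 10 ≤ |inverseBranch ε (Fin.rev 0) i x - inverseBranch ε (Fin.rev 0) i' y|
    rw [inverseBranch_rev, inverseBranch_rev, sub_sub_sub_cancel_left, abs_sub_comm]
    exact h0 _ (one_sub_mem_unitInterval hx) _ (one_sub_mem_unitInterval hy)

theorem measurable_inverseBranch (ε : ℝ) (j i : Fin 2) : Measurable (inverseBranch ε j i) := by
  have h : Measurable (moebiusInverse ε) := by
    unfold moebiusInverse; fun_prop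
  fin_cases j <;> fin_cases i
  · exact h
  · change Measurable fun x : ℝ => (x + 19) / 20
    fun_prop
  · change Measurable fun x : ℝ => 1 - moebiusInverse ε (1 - x)
    fun_prop
  · change Measurable fun x : ℝ => 1 - (1 - x + 19) / 20
    fun_prop

/-- The largest derivative of the Möbius inverse is `1 / (1 + ε)` for `ε ≤ 19` and `(1 + ε) / 400`
beyond; `ε < 399` keeps it below `1`. -/
theorem exists_isMoebiusSystem {ε : ℝ} (hε : 0 < ε) (hε' : ε < 399) :
    ∃ ρ lam M δ : ℝ, IsMoebiusSystem (inverseBranch ε) ρ lam M δ := by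
  have hmin : 1 < min (1 + ε) 20 := lt_min (by linarith) (by norm_num)
  have hρ1 : (1 + ε) / min (1 + ε) 20 ^ 2 < 1 := by
    rw [div_lt_one (by positivity)]
    rcases min_choice (1 + ε) 20 with h | h <;> rw [h] at hmin ⊢ <;> nlinarith
  have hlam : 0 < (1 + ε) / max (1 + ε) 20 ^ 2 := by positivity
  set ρ := max (1 / 20) ((1 + ε) / min (1 + ε) 20 ^ 2)
  set lam := min (1 / 20) ((1 + ε) / max (1 + ε) 20 ^ 2)
  have hmob : HasMoebiusMultiplier (moebiusInverse ε) ρ lam |19 - ε| :=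
    hasMoebiusMultiplier_moebiusInverse hε (le_max_right _ _) (min_le_right _ _) le_rfl
  have haff : HasMoebiusMultiplier (fun x => (x + 19) / 20) ρ lam |19 - ε| :=
    hasMoebiusMultiplier_affine (le_max_left _ _) (min_le_left _ _) (abs_nonneg _)
  refine ⟨ρ, lam, |19 - ε|, 9 / 10, ?_⟩
  exact
    { rho_nonneg := le_trans (by norm_num) (le_max_left _ _)
      rho_lt_one := max_lt (by norm_num) hρ1
      lam_pos := lt_min (by norm_num) hlam
      lam_le_one := (min_le_left _ _).trans (by norm_num)
      M_nonneg := abs_nonneg _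
      sep_pos := by norm_num
      mapsTo := inverseBranch_mapsTo hε
      measurable := measurable_inverseBranch ε
      exists_multiplier := fun j i => by
        fin_cases j <;> fin_cases i
        · exact hmob
        · exact haff
        · exact hmob.reflect
        · exact haff.reflect
      sep := fun j i i' hi x hx y hy => inverseBranch_sep hε j hi hx hy }

theorem mem_exampleMapZero_iff {ε : ℝ} (hε : 0 < ε) {x y : ℝ} :
    y ∈ exampleMapZero ε x ↔ y ∈ Icc (0 : ℝ) 1 ∧ ∃ i, inverseBranch ε 0 i y = x := by
  rw [exampleMapZero, PFun.mem_res, Fin.exists_fin_two]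
  change _ ↔ _ ∧ (moebiusInverse ε y = x ∨ (y + 19) / 20 = x)
  constructor
  · rintro ⟨hx, rfl⟩
    rcases hx with hx | hx
    · rw [if_pos hx.2]
      have hd : 0 < 1 - (19 - ε) * x := by nlinarith [hx.1, hx.2]
      have hn : 0 ≤ (1 + ε) * x := mul_nonneg (by linarith) hx.1
      refine ⟨⟨div_nonneg hn hd.le, ?_⟩, Or.inl ?_⟩
      · rw [moebiusBranch, div_le_one hd]; linarith [hx.2]
      · have ha : (1 + ε) ≠ 0 := by linarith
        have h : (1 + ε) + (19 - ε) * moebiusBranch ε x = (1 + ε) / (1 - (19 - ε) * x) := by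
          rw [moebiusBranch]; field_simp; ring
        rw [moebiusInverse, h, moebiusBranch, div_div_div_cancel_right₀ hd.ne', mul_div_assoc,
          mul_div_cancel₀ _ ha]
    · rw [if_neg (by linarith [hx.1])]
      exact ⟨⟨by linarith [hx.1], by linarith [hx.2]⟩, Or.inr (by ring)⟩
  · rintro ⟨hy, rfl | rfl⟩
    · have hm := moebiusInverse_mem hε hy
      refine ⟨Or.inl hm, ?_⟩
      rw [if_pos hm.2]
      have hd := moebiusInverse_den_pos hε hy
      have ha : (1 + ε) ≠ 0 := by linarith
      have h : 1 - (19 - ε) * moebiusInverse ε y = (1 + ε) / ((1 + ε) + (19 - ε) * y) := by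
        rw [moebiusInverse]; field_simp; ring
      rw [moebiusBranch, h, moebiusInverse, ← mul_div_assoc, div_div_div_cancel_right₀ hd.ne',
        mul_div_cancel_left₀ _ ha]
    · refine ⟨Or.inr ⟨by linarith [hy.1], by linarith [hy.2]⟩, ?_⟩
      rw [if_neg (by linarith [hy.1])]
      ring

theorem mem_exampleMap_iff {ε : ℝ} (hε : 0 < ε) (j : Fin 2) {x y : ℝ} :
    y ∈ exampleMap ε j x ↔ y ∈ Icc (0 : ℝ) 1 ∧ ∃ i, inverseBranch ε j i y = x := by
  fin_cases j
  · exact mem_exampleMapZero_iff hε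
  · change y ∈ (exampleMapZero ε (1 - x)).map (fun y => 1 - y) ↔
      y ∈ Icc (0 : ℝ) 1 ∧ ∃ i, inverseBranch ε (Fin.rev 0) i y = x
    simp only [Part.mem_map_iff, mem_exampleMapZero_iff hε, inverseBranch_rev]
    constructor
    · rintro ⟨z, ⟨hz, i, hi⟩, rfl⟩
      exact ⟨one_sub_mem_unitInterval hz, i, by rw [sub_sub_cancel, hi, sub_sub_cancel]⟩
    · rintro ⟨hy, i, rfl⟩
      exact ⟨1 - y, ⟨one_sub_mem_unitInterval hy, i, by rw [sub_sub_cancel]⟩, by ring⟩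

/-! ### Domains of the partial maps as limit sets, and the reflection symmetry. -/

theorem sequentialComp_succ' (G : ℕ → ℝ →. ℝ) (n : ℕ) :
    sequentialComp G (n + 1) = (sequentialComp (fun k => G (k + 1)) n).comp (G 0) := by
  induction n with
  | zero => simp only [sequentialComp, PFun.comp_id, PFun.id_comp]
  | succ n ih => rw [sequentialComp, ih, sequentialComp, PFun.comp_assoc]

theorem sequentialComp_const_comp {ι : Type*} (F : ι → ℝ →. ℝ) (c : ℕ → ι) (a b : ι)
    (ha : ∀ n, c (2 * n) = a) (hb : ∀ n, c (2 * n + 1) = b) (n : ℕ) :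
    sequentialComp (fun _ => (F b).comp (F a)) n = sequentialComp (fun m => F (c m)) (2 * n) := by
  induction n with
  | zero => rfl
  | succ n ih =>
    rw [mul_add, mul_one, sequentialComp, sequentialComp, sequentialComp, ih, ha, hb,
      PFun.comp_assoc]

theorem levelSet_inverseBranch {ε : ℝ} (hε : 0 < ε) (c : ℕ → Fin 2) (n : ℕ) :
    {x | x ∈ Icc (0 : ℝ) 1 ∧ x ∈ (sequentialComp (fun m => exampleMap ε (c m)) n).Dom} =
      levelSet (inverseBranch ε) c n := by
  induction n generalizing c with
  | zero =>
    rw [levelSet_zero]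
    ext x
    exact ⟨fun h => h.1, fun h => ⟨h, trivial⟩⟩
  | succ n ih =>
    ext x
    rw [mem_levelSet_succ, ← ih, mem_ofPred_eq, sequentialComp_succ', PFun.dom_comp,
      PFun.mem_preimage]
    constructor
    · rintro ⟨-, y, hy, hyx⟩
      obtain ⟨hI, i, hi⟩ := (mem_exampleMap_iff hε (c 0)).1 hyx
      exact ⟨i, y, ⟨hI, hy⟩, hi⟩
    · rintro ⟨i, y, ⟨hI, hy⟩, rfl⟩
      exact ⟨inverseBranch_mapsTo hε _ _ hI, y, hy, (mem_exampleMap_iff hε (c 0)).2 ⟨hI, i, rfl⟩⟩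

theorem cookieCutterLikeSet_exampleMap {ε : ℝ} (hε : 0 < ε) (c : ℕ → Fin 2) :
    cookieCutterLikeSet (exampleMap ε) c = limitSet (inverseBranch ε) c := by
  ext x
  simp only [limitSet, mem_iInter, ← levelSet_inverseBranch hε]
  exact ⟨fun h n => ⟨h.1, h.2 n⟩, fun h => ⟨(h 0).1, fun n => (h n).2⟩⟩

theorem cookieCutterSet_exampleMap {ε : ℝ} (hε : 0 < ε) (j : Fin 2) :
    cookieCutterSet (exampleMap ε j) = limitSet (inverseBranch ε) fun _ => j :=
  cookieCutterLikeSet_exampleMap hε fun _ => j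

/-- Iterates of the composed map test only the even levels; nestedness of the levels supplies the
odd ones. -/
theorem cookieCutterSet_comp_exampleMap {ε : ℝ} (hε : 0 < ε) {c : ℕ → Fin 2} {a b : Fin 2}
    (ha : ∀ n, c (2 * n) = a) (hb : ∀ n, c (2 * n + 1) = b)
    (hanti : Antitone (levelSet (inverseBranch ε) c)) :
    cookieCutterSet ((exampleMap ε b).comp (exampleMap ε a)) = limitSet (inverseBranch ε) c := by
  ext x
  simp only [cookieCutterSet, sequentialComp_const_comp (exampleMap ε) c a b ha hb, limitSet,
    mem_iInter]
  have hl := levelSet_inverseBranch hε c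
  constructor
  · rintro ⟨hI, h⟩ n
    refine hanti (show n ≤ 2 * n by omega) ?_
    rw [← hl]
    exact ⟨hI, h n⟩
  · intro h
    simp only [← hl] at h
    exact ⟨(h 0).1, fun n => (h (2 * n)).2⟩

theorem branch_inverseBranch_rev (ε : ℝ) (c : ℕ → Fin 2) (n : ℕ) (w : Fin n → Fin 2) (x : ℝ) :
    branch (inverseBranch ε) (fun k => (c k).rev) n w x =
      1 - branch (inverseBranch ε) c n w (1 - x) := by
  induction n generalizing c with
  | zero => simp [branch]
  | succ n ih =>
    rw [branch, branch, Function.comp_apply, Function.comp_apply, inverseBranch_rev,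
      ih (fun k => c (k + 1)), sub_sub_cancel]

theorem dimH_limitSet_rev_le (ε : ℝ) (c : ℕ → Fin 2) :
    dimH (limitSet (inverseBranch ε) c) ≤
      dimH (limitSet (inverseBranch ε) fun k => (c k).rev) := by
  have hiso : Isometry fun x : ℝ => 1 - x := Isometry.of_dist_eq fun x y => by
    rw [Real.dist_eq, Real.dist_eq, sub_sub_sub_cancel_left, abs_sub_comm]
  rw [← hiso.dimH_image (limitSet (inverseBranch ε) c)]
  refine dimH_mono ?_
  rintro _ ⟨x, hx, rfl⟩
  refine mem_iInter.2 fun n => ?_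
  obtain ⟨w, y, hy, rfl⟩ := mem_iUnion.1 (mem_iInter.1 hx n)
  exact mem_iUnion.2 ⟨w, 1 - y, one_sub_mem_unitInterval hy, by
    rw [branch_inverseBranch_rev, sub_sub_cancel]⟩

theorem dimH_limitSet_rev (ε : ℝ) (c : ℕ → Fin 2) :
    dimH (limitSet (inverseBranch ε) fun k => (c k).rev) = dimH (limitSet (inverseBranch ε) c) :=
  le_antisymm (by simpa using dimH_limitSet_rev_le ε fun k => (c k).rev) (dimH_limitSet_rev_le ε c)

/-! ### Cookie-cutter regularity of the two maps. -/

/-- A sufficient condition for a map to be an increasing full branch of a `C^{1+1}` cookie-cutter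
map. -/
theorem regular_branch_of_hasDerivAt {a b : ℝ} (hab : a < b) {f g g' : ℝ → ℝ}
    (hfg : EqOn f g (Icc a b)) (hg : ∀ x ∈ Icc a b, HasDerivAt g (g' x) x)
    (h1 : ∀ x ∈ Icc a b, 1 < g' x) (hg' : ContDiffOn ℝ 1 g' (Icc a b)) (ha : g a = 0)
    (hb : g b = 1) :
    BijOn f (Icc a b) (Icc 0 1) ∧ ContDiffOn ℝ 1 f (Icc a b) ∧
      (∀ x ∈ Icc a b, 1 < |derivWithin f (Icc a b) x|) ∧
      ∃ C : ℝ≥0, HolderOnWith C (1 : ℝ≥0) (derivWithin f (Icc a b)) (Icc a b) := by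
  have hu := uniqueDiffOn_Icc hab
  have hcont : ContinuousOn g (Icc a b) := fun x hx => (hg x hx).continuousAt.continuousWithinAt
  have hmono : StrictMonoOn g (Icc a b) :=
    strictMonoOn_of_hasDerivWithinAt_pos (convex_Icc a b) hcont
      (fun x hx => (hg x (interior_subset hx)).hasDerivWithinAt)
      fun x hx => zero_lt_one.trans (h1 x (interior_subset hx))
  have hbij : BijOn g (Icc a b) (Icc 0 1) := by
    refine ⟨fun x hx => ?_, hmono.injOn, ?_⟩
    · rw [← ha, ← hb]
      exact ⟨hmono.monotoneOn (left_mem_Icc.2 hab.le) hx hx.1,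
        hmono.monotoneOn hx (right_mem_Icc.2 hab.le) hx.2⟩
    · have := intermediate_value_Icc hab.le hcont
      rwa [ha, hb] at this
  have hd : EqOn (derivWithin f (Icc a b)) g' (Icc a b) := fun x hx => by
    rw [derivWithin_congr hfg (hfg hx)]
    exact (hg x hx).hasDerivWithinAt.derivWithin (hu x hx)
  refine ⟨hbij.congr hfg.symm, ?_, fun x hx => ?_, ?_⟩
  · refine ContDiffOn.congr ((contDiffOn_one_iff_derivWithin hu).2
      ⟨fun x hx => (hg x hx).differentiableAt.differentiableWithinAt, ?_⟩) hfg
    exact hg'.continuousOn.congr fun x hx => (hg x hx).hasDerivWithinAt.derivWithin (hu x hx)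
  · rw [hd hx]
    exact (h1 x hx).trans_le (le_abs_self _)
  · obtain ⟨C, hC⟩ := hg'.exists_lipschitzOnWith one_ne_zero (convex_Icc a b) isCompact_Icc
    refine ⟨C, LipschitzOnWith.holderOnWith fun x hx y hy => ?_⟩
    rw [hd hx, hd hy]
    exact hC hx hy

theorem moebiusBranch_den_pos {ε x : ℝ} (hε : 0 < ε) (hx : x ∈ Icc (0 : ℝ) (1 / 20)) :
    0 < 1 - (19 - ε) * x := by
  nlinarith [hx.1, hx.2]

theorem hasDerivAt_moebiusBranch {ε x : ℝ} (hx : 1 - (19 - ε) * x ≠ 0) :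
    HasDerivAt (moebiusBranch ε) ((1 + ε) / (1 - (19 - ε) * x) ^ 2) x := by
  have h1 : HasDerivAt (fun x : ℝ => (1 + ε) * x) ((1 + ε) * 1) x :=
    (hasDerivAt_id x).const_mul (1 + ε)
  have h2 : HasDerivAt (fun x : ℝ => 1 - (19 - ε) * x) (-((19 - ε) * 1)) x :=
    ((hasDerivAt_id x).const_mul (19 - ε)).const_sub 1
  have h3 : HasDerivAt (moebiusBranch ε) _ x := h1.div h2 hx
  exact h3.congr_deriv (by congr 1; ring)

theorem one_lt_deriv_moebiusBranch {ε x : ℝ} (hε : 0 < ε) (hε' : ε < 399)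
    (hx : x ∈ Icc (0 : ℝ) (1 / 20)) : 1 < (1 + ε) / (1 - (19 - ε) * x) ^ 2 := by
  have hd := moebiusBranch_den_pos hε hx
  rw [one_lt_div (by positivity)]
  -- The denominator is monotone in `x`: its maximum is `1` at `0` if `ε ≤ 19`, and `(1 + ε) / 20`
  -- at `1/20` otherwise.
  rcases le_total ε 19 with h | h
  · nlinarith [mul_nonneg (sub_nonneg.2 h) hx.1]
  · have h1 : 1 - (19 - ε) * x ≤ (1 + ε) / 20 := by
      nlinarith [mul_nonneg (sub_nonneg.2 h) (sub_nonneg.2 hx.2)]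
    nlinarith

theorem contDiffOn_deriv_moebiusBranch {ε : ℝ} (hε : 0 < ε) :
    ContDiffOn ℝ 1 (fun x => (1 + ε) / (1 - (19 - ε) * x) ^ 2) (Icc (0 : ℝ) (1 / 20)) := by
  refine ContDiffOn.div (by fun_prop) (by fun_prop) fun x hx => ?_
  exact (pow_pos (moebiusBranch_den_pos hε hx) 2).ne'

theorem dom_exampleMapZero (ε : ℝ) :
    (exampleMapZero ε).Dom = Icc 0 (1 / 20) ∪ Icc (19 / 20) 1 := rfl

theorem mem_exampleMapZero_of_mem_dom {ε x : ℝ} (hx : x ∈ (exampleMapZero ε).Dom) :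
    (if x ≤ 1 / 20 then moebiusBranch ε x else 20 * x - 19) ∈ exampleMapZero ε x :=
  (PFun.mem_res _ _ _ _).2 ⟨hx, rfl⟩

theorem iUnion_branch_intervals :
    ⋃ i, Icc ((![0, 19 / 20] : Fin 2 → ℝ) i) ((![1 / 20, 1] : Fin 2 → ℝ) i) =
      Icc 0 (1 / 20) ∪ Icc (19 / 20) 1 := by
  ext x
  simp only [mem_iUnion, Fin.exists_fin_two]
  rfl

theorem isCookieCutter_of_two_branches {F : ℝ →. ℝ} {f g₀ g₀' g₁ g₁' : ℝ → ℝ}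
    (hdom : F.Dom = Icc 0 (1 / 20) ∪ Icc (19 / 20) 1) (hf : ∀ x ∈ F.Dom, f x ∈ F x)
    (e₀ : EqOn f g₀ (Icc 0 (1 / 20))) (e₁ : EqOn f g₁ (Icc (19 / 20) 1))
    (d₀ : ∀ x ∈ Icc (0 : ℝ) (1 / 20), HasDerivAt g₀ (g₀' x) x)
    (d₁ : ∀ x ∈ Icc (19 / 20 : ℝ) 1, HasDerivAt g₁ (g₁' x) x)
    (l₀ : ∀ x ∈ Icc (0 : ℝ) (1 / 20), 1 < g₀' x) (l₁ : ∀ x ∈ Icc (19 / 20 : ℝ) 1, 1 < g₁' x)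
    (c₀ : ContDiffOn ℝ 1 g₀' (Icc 0 (1 / 20))) (c₁ : ContDiffOn ℝ 1 g₁' (Icc (19 / 20) 1))
    (z₀ : g₀ 0 = 0) (o₀ : g₀ (1 / 20) = 1) (z₁ : g₁ (19 / 20) = 0) (o₁ : g₁ 1 = 1) :
    IsCookieCutter 1 F := by
  refine ⟨2, ![0, 19 / 20], ![1 / 20, 1], f, ?_, ?_, ?_, hf, ?_⟩
  · rw [Fin.forall_fin_two]
    exact ⟨⟨by norm_num, Icc_subset_Icc le_rfl (by norm_num)⟩,
      ⟨by norm_num, Icc_subset_Icc (by norm_num) le_rfl⟩⟩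
  · have h : Disjoint (Icc (0 : ℝ) (1 / 20)) (Icc (19 / 20) 1) :=
      Set.disjoint_left.2 fun x hx hx' => by linarith [hx.2, hx'.1]
    intro i j hij
    fin_cases i <;> fin_cases j
    · exact absurd rfl hij
    · exact h
    · exact h.symm
    · exact absurd rfl hij
  · rw [hdom, iUnion_branch_intervals]
  · rw [Fin.forall_fin_two]
    exact ⟨regular_branch_of_hasDerivAt (by norm_num) e₀ d₀ l₀ c₀ z₀ o₀,
      regular_branch_of_hasDerivAt (by norm_num) e₁ d₁ l₁ c₁ z₁ o₁⟩

theorem isCookieCutter_exampleMap {ε : ℝ} (hε : 0 < ε) (hε' : ε < 399) (j : Fin 2) :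
    IsCookieCutter 1 (exampleMap ε j) := by
  have hspec := moebiusBranch_spec hε
  have hr₀ : ∀ {x : ℝ}, x ∈ Icc (0 : ℝ) (1 / 20) → 1 - x ∈ Icc (19 / 20 : ℝ) 1 := fun hx =>
    ⟨by linarith [hx.2], by linarith [hx.1]⟩
  have hr₁ : ∀ {x : ℝ}, x ∈ Icc (19 / 20 : ℝ) 1 → 1 - x ∈ Icc (0 : ℝ) (1 / 20) := fun hx =>
    ⟨by linarith [hx.2], by linarith [hx.1]⟩
  have hmoeb : ∀ x ∈ Icc (0 : ℝ) (1 / 20),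
      HasDerivAt (moebiusBranch ε) ((1 + ε) / (1 - (19 - ε) * x) ^ 2) x := fun x hx =>
    hasDerivAt_moebiusBranch (moebiusBranch_den_pos hε hx).ne'
  fin_cases j
  · refine isCookieCutter_of_two_branches (F := exampleMapZero ε) (g₀ := moebiusBranch ε)
      (g₁ := fun x => 20 * x - 19) (g₁' := fun _ => 20) (dom_exampleMapZero ε)
      (fun x hx => mem_exampleMapZero_of_mem_dom hx) (fun x hx => if_pos hx.2)
      (fun x hx => if_neg (by linarith [hx.1])) hmoeb
      (fun x _ => ?_) (fun x hx => one_lt_deriv_moebiusBranch hε hε' hx) (fun _ _ => by norm_num)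
      (contDiffOn_deriv_moebiusBranch hε) contDiffOn_const hspec.1 hspec.2.2 (by norm_num)
      (by norm_num)
    simpa using ((hasDerivAt_id x).const_mul 20).sub_const 19
  · have hdom : (exampleMapOne ε).Dom = Icc 0 (1 / 20) ∪ Icc (19 / 20) 1 := by
      ext x
      change 1 - x ∈ Icc (0 : ℝ) (1 / 20) ∪ Icc (19 / 20) 1 ↔ _
      constructor
      · rintro (h | h)
        · exact Or.inr (by simpa using hr₀ h)
        · exact Or.inl (by simpa using hr₁ h)
      · rintro (h | h)
        · exact Or.inr (hr₀ h)
        · exact Or.inl (hr₁ h)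
    have hsub : ∀ x : ℝ, HasDerivAt (fun x : ℝ => 1 - x) (-1) x := fun x => by
      simpa using (hasDerivAt_id x).const_sub 1
    refine isCookieCutter_of_two_branches (F := exampleMapOne ε)
      (f := fun x => 1 - if 1 - x ≤ 1 / 20 then moebiusBranch ε (1 - x) else 20 * (1 - x) - 19)
      (g₀ := fun x => 20 * x) (g₀' := fun _ => 20) (g₁ := fun x => 1 - moebiusBranch ε (1 - x))
      (g₁' := fun x => (1 + ε) / (1 - (19 - ε) * (1 - x)) ^ 2) hdom
      (fun x hx => Part.mem_map _ (mem_exampleMapZero_of_mem_dom hx)) (fun x hx => ?_)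
      (fun x hx => ?_) (fun x _ => ?_) (fun x hx => ?_) (fun _ _ => by norm_num)
      (fun x hx => one_lt_deriv_moebiusBranch hε hε' (hr₁ hx)) contDiffOn_const ?_ (by norm_num)
      (by norm_num) ?_ (by simp [hspec.1])
    · simp only [if_neg (show ¬ 1 - x ≤ 1 / 20 by linarith [hx.2])]
      ring
    · simp only [if_pos (show 1 - x ≤ 1 / 20 by linarith [hx.1])]
    · simpa using (hasDerivAt_id x).const_mul 20
    · simpa using ((hmoeb _ (hr₁ hx)).comp x (hsub x)).const_sub 1
    · exact (contDiffOn_deriv_moebiusBranch hε).comp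
        (g := fun x => (1 + ε) / (1 - (19 - ε) * x) ^ 2)
        (f := fun x => 1 - x) (by fun_prop) fun x hx => hr₁ hx
    · rw [show (1 : ℝ) - 19 / 20 = 1 / 20 by norm_num, hspec.2.2, sub_self]

/-- Expansion at `1/20` bounds the parameter of a cookie-cutter `F₀`. -/
theorem lt_of_isCookieCutter {ε : ℝ} (hε : 0 < ε) {τ : ℝ≥0}
    (h : IsCookieCutter τ (exampleMapZero ε)) : ε < 399 := by
  obtain ⟨q, a, b, f, hab, -, hdom, hf, hbr⟩ := h
  have hmem : (1 / 20 : ℝ) ∈ ⋃ i, Icc (a i) (b i) := by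
    rw [← hdom, dom_exampleMapZero]
    exact Or.inl (by norm_num)
  obtain ⟨i, hi⟩ := mem_iUnion.1 hmem
  have hsub : Icc (a i) (b i) ⊆ Icc 0 (1 / 20) ∪ Icc (19 / 20) 1 := by
    rw [← dom_exampleMapZero ε, hdom]
    exact subset_iUnion (fun i => Icc (a i) (b i)) i
  have hb : b i ≤ 1 / 20 := by
    by_contra! hlt
    -- The component containing `1/20` cannot extend to the right: this point of it would lie in the
    -- gap of the domain.
    have hz : min (b i) (1 / 2) ∈ Icc (a i) (b i) :=
      ⟨le_min (hab i).1.le (hi.1.trans (by norm_num)), min_le_left _ _⟩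
    have h1 : 1 / 20 < min (b i) (1 / 2) := lt_min hlt (by norm_num)
    have h2 := min_le_right (b i) (1 / 2)
    rcases hsub hz with h | h
    · linarith [h.2]
    · linarith [h.1]
  have heq : EqOn f (moebiusBranch ε) (Icc (a i) (b i)) := fun x hx => by
    have hd : x ∈ (exampleMapZero ε).Dom := by rw [hdom]; exact mem_iUnion.2 ⟨i, hx⟩
    have h1 := Part.mem_unique (hf x hd) (mem_exampleMapZero_of_mem_dom hd)
    rwa [if_pos (hx.2.trans hb)] at h1
  have h20 : (1 / 20 : ℝ) ∈ Icc (0 : ℝ) (1 / 20) := by norm_num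
  have h1 := (hbr i).2.2.1 _ hi
  rw [derivWithin_congr heq (heq hi),
    (hasDerivAt_moebiusBranch (moebiusBranch_den_pos hε h20).ne').hasDerivWithinAt.derivWithin
      (uniqueDiffOn_Icc (hab i).1 _ hi),
    -- The derivative at `1/20` is `400 / (1 + ε)`.
    show 1 - (19 - ε) * (1 / 20) = (1 + ε) / 20 by ring, abs_of_pos (by positivity),
    one_lt_div (by positivity)] at h1
  nlinarith

/-! ### Lower bound `1/2` for `F₀` from the nearly parabolic fixed point. -/

section LowerBound

/-- In the coordinate `u = 1 / x` the map is affine, `u ↦ (1 + ε) * u + (19 - ε)`. Apart from the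
factor `(1 + ε) ^ n`, the translation part `β` grows at most linearly in `n`, as for a parabolic
map. -/
theorem exists_iterate_moebiusInverse {ε : ℝ} (hε : 0 < ε) (hε' : ε ≤ 19) (n : ℕ) :
    ∃ β : ℝ, 0 ≤ β ∧ β ≤ 19 * n * (1 + ε) ^ n ∧ ∀ x ∈ Icc (0 : ℝ) 1,
      (moebiusInverse ε)^[n] x = x / ((1 + ε) ^ n + β * x) := by
  induction n with
  | zero => exact ⟨0, le_rfl, by simp, fun x _ => by simp⟩
  | succ n ih =>
    obtain ⟨β, h0, h1, h2⟩ := ih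
    have ha : 1 ≤ (1 + ε) ^ (n + 1) := one_le_pow₀ (by linarith)
    refine ⟨(1 + ε) * β + (19 - ε), by nlinarith, ?_, fun x hx => ?_⟩
    · have h3 : (1 + ε) * β ≤ 19 * n * (1 + ε) ^ (n + 1) := by
        calc _ ≤ (1 + ε) * (19 * n * (1 + ε) ^ n) := by gcongr
          _ = _ := by ring
      push_cast
      nlinarith
    · have hD : 0 < (1 + ε) ^ n + β * x :=
        add_pos_of_pos_of_nonneg (by positivity) (mul_nonneg h0 hx.1)
      rw [Function.iterate_succ_apply', h2 x hx, moebiusInverse]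
      have h4 : (1 + ε) + (19 - ε) * (x / ((1 + ε) ^ n + β * x)) =
          ((1 + ε) ^ (n + 1) + ((1 + ε) * β + (19 - ε)) * x) / ((1 + ε) ^ n + β * x) := by
        rw [eq_div_iff hD.ne']
        linear_combination (19 - ε) * div_mul_cancel₀ x hD.ne'
      rw [h4, div_div_div_cancel_right₀ hD.ne']

theorem iterate_moebiusInverse_dist {ε : ℝ} (hε : 0 < ε) (hε' : ε ≤ 19) (n : ℕ) {x y : ℝ}
    (hx : x ∈ Icc (0 : ℝ) 1) (hy : y ∈ Icc (0 : ℝ) 1) :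
    |(moebiusInverse ε)^[n] x - (moebiusInverse ε)^[n] y| ≤ |x - y| ∧
      1 / ((1 + ε) ^ n * (1 + 19 * n) ^ 2) * |x - y| ≤
        |(moebiusInverse ε)^[n] x - (moebiusInverse ε)^[n] y| := by
  obtain ⟨β, h0, h1, h2⟩ := exists_iterate_moebiusInverse hε hε' n
  have ha : 1 ≤ (1 + ε) ^ n := one_le_pow₀ (by linarith)
  set a := (1 + ε) ^ n
  have hD : ∀ {z : ℝ}, z ∈ Icc (0 : ℝ) 1 → a ≤ a + β * z ∧ a + β * z ≤ a * (1 + 19 * n) :=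
    fun hz => ⟨by nlinarith [mul_nonneg h0 hz.1], by nlinarith [mul_nonneg h0 (sub_nonneg.2 hz.2)]⟩
  have hDx := hD hx
  have hDy := hD hy
  have hx0 : 0 < a + β * x := by linarith
  have hy0 : 0 < a + β * y := by linarith
  have hsub : (moebiusInverse ε)^[n] x - (moebiusInverse ε)^[n] y =
      a / ((a + β * x) * (a + β * y)) * (x - y) := by
    rw [h2 x hx, h2 y hy, div_sub_div _ _ hx0.ne' hy0.ne', div_mul_eq_mul_div]
    congr 1
    ring
  have ha0 : 0 < a := by linarith
  rw [hsub, abs_mul, abs_of_pos (by positivity : 0 < a / ((a + β * x) * (a + β * y)))]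
  constructor
  · refine mul_le_of_le_one_left (abs_nonneg _) ?_
    rw [div_le_one (by positivity)]
    calc a ≤ a * a := by nlinarith
      _ ≤ _ := mul_le_mul hDx.1 hDy.1 ha0.le hx0.le
  · refine mul_le_mul_of_nonneg_right ?_ (abs_nonneg _)
    rw [div_le_div_iff₀ (by positivity) (by positivity), one_mul]
    calc _ ≤ a * (1 + 19 * n) * (a * (1 + 19 * n)) :=
          mul_le_mul hDx.2 hDy.2 hy0.le (by positivity)
      _ = _ := by ring

/-- The induced maps `φ₀ⁿ ∘ φ₁` of the nearly parabolic system have square-root ratios comparable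
to the harmonic series. -/
theorem half_le_dimH_limitSet_zero {ε : ℝ} (hε : 0 < ε) (hε' : ε ≤ 19) {N : ℕ}
    (hN : 9 ≤ ∑ n : Fin (N + 1), 1 / (1 + 19 * ((n : ℕ) : ℝ))) (hεN : (1 + ε) ^ N ≤ 4)
    (hanti : Antitone (levelSet (inverseBranch ε) fun _ => 0)) :
    ((1 / 2 : ℝ≥0) : ℝ≥0∞) ≤ dimH (limitSet (inverseBranch ε) fun _ => 0) := by
  set g : ℝ → ℝ := fun x => (x + 19) / 20
  have hg : ∀ x ∈ Icc (0 : ℝ) 1, g x ∈ Icc (19 / 20 : ℝ) 1 := fun x hx =>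
    ⟨by simp only [g]; linarith [hx.1], by simp only [g]; linarith [hx.2]⟩
  have hgI : MapsTo g (Icc 0 1) (Icc 0 1) := fun x hx =>
    Icc_subset_Icc_left (by norm_num) (hg x hx)
  have hφI : MapsTo (moebiusInverse ε) (Icc 0 1) (Icc 0 1) := fun x hx =>
    Icc_subset_Icc_right (by norm_num) (moebiusInverse_mem hε hx)
  have hgd : ∀ x y, |g x - g y| = 1 / 20 * |x - y| := fun x y => by
    rw [show g x - g y = 1 / 20 * (x - y) by simp only [g]; ring, abs_mul,
      abs_of_pos (by norm_num : (0 : ℝ) < 1 / 20)]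
  have hpow : ∀ n ≤ N, (1 + ε) ^ n ≤ 4 := fun n hn =>
    (pow_le_pow_right₀ (by linarith) hn).trans hεN
  have hlow : ∀ n ≤ N, ∀ x ∈ Icc (0 : ℝ) 1, ∀ y ∈ Icc (0 : ℝ) 1,
      1 / (4 * (1 + 19 * n) ^ 2) * |x - y| ≤
        |(moebiusInverse ε)^[n] x - (moebiusInverse ε)^[n] y| := fun n hn x hx y hy => by
    refine le_trans ?_ (iterate_moebiusInverse_dist hε hε' n hx hy).2
    have := hpow n hn
    gcongr
  have hsep : ∀ n ≤ N, ∀ m, n < m → ∀ x ∈ Icc (0 : ℝ) 1, ∀ y ∈ Icc (0 : ℝ) 1,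
      1 / (4 * (1 + 19 * (N : ℝ)) ^ 2) * (9 / 10) ≤
        |(moebiusInverse ε)^[n] (g x) - (moebiusInverse ε)^[m] (g y)| := by
    intro n hn m hnm x hx y hy
    -- After removing the common `n` iterates, one point lies in `[19/20, 1]` and the other in `[0,
    -- 1/20]`.
    obtain ⟨k, rfl⟩ : ∃ k, m = n + (k + 1) := ⟨m - n - 1, by omega⟩
    rw [Function.iterate_add_apply]
    have hk := hφI.iterate k (hgI hy)
    have h1 := moebiusInverse_mem hε hk
    rw [← Function.iterate_succ_apply' (moebiusInverse ε)] at h1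
    refine le_trans ?_ (hlow n hn _ (hgI hx) _ (Icc_subset_Icc_right (by norm_num) h1))
    have h2 : 9 / 10 ≤ |g x - (moebiusInverse ε)^[k + 1] (g y)| :=
      le_trans (by linarith [(hg x hx).1, h1.2]) (le_abs_self _)
    gcongr
  -- An induced map uses several letters, but it is enough to count one level for each: the levels
  -- gained by the iterates are given up by nestedness.
  have hlevel : ∀ n m, ∀ y ∈ levelSet (inverseBranch ε) (fun _ => 0) m,
      (moebiusInverse ε)^[n] y ∈ levelSet (inverseBranch ε) (fun _ => 0) m := by
    intro n m
    induction n with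
    | zero => exact fun y hy => hy
    | succ n ih =>
      intro y hy
      rw [Function.iterate_succ_apply']
      exact hanti m.le_succ (mem_levelSet_succ.2 ⟨0, _, ih y hy, rfl⟩)
  refine (le_dimH_of_lower_ratios (ι := fun _ => Fin (N + 1))
    (φ := fun _ n => (moebiusInverse ε)^[(n : ℕ)] ∘ g) (ρ := 1 / 20)
    (fun _ n => (hφI.iterate n).comp hgI)
    (fun _ n => ((measurable_inverseBranch ε 0 0).iterate n).comp (measurable_inverseBranch ε 0 1))
    (by norm_num) (fun _ n x hx y hy => ?_)
    -- The available constant is `1 / (20 * 4)`; replacing `80` by the square `81` makes the square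
    -- root exact and accounts for the `9` in `hN`.
    (c := fun _ n => (1 / (9 * (1 + 19 * ((n : ℕ) : ℝ)))) ^ 2)
    (fun _ n => by positivity) (fun _ n x hx y hy => ?_)
    (δ := 1 / (4 * (1 + 19 * (N : ℝ)) ^ 2) * (9 / 10)) (by positivity)
    (fun _ n m hnm x hx y hy => ?_) (fun _ => ?_)).trans (dimH_mono ?_)
  · exact (iterate_moebiusInverse_dist hε hε' n (hgI hx) (hgI hy)).1.trans (hgd x y).le
  · refine le_trans ?_ (hlow n (Nat.lt_succ_iff.1 n.2) _ (hgI hx) _ (hgI hy))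
    rw [hgd, ← mul_assoc]
    refine mul_le_mul_of_nonneg_right ?_ (abs_nonneg _)
    rw [div_pow, one_pow, mul_pow, div_mul_div_comm, one_mul]
    refine one_div_le_one_div_of_le (by positivity) ?_
    nlinarith [sq_nonneg (1 + 19 * ((n : ℕ) : ℝ))]
  · rcases lt_or_gt_of_ne (fun h => hnm (Fin.ext h)) with h | h
    · exact hsep n (Nat.lt_succ_iff.1 n.2) m h x hx y hy
    · rw [abs_sub_comm]
      exact hsep m (Nat.lt_succ_iff.1 m.2) n h y hy x hx
  · have h1 : ∀ n : Fin (N + 1), ((1 / (9 * (1 + 19 * ((n : ℕ) : ℝ)))) ^ 2) ^ ((1 / 2 : ℝ≥0) : ℝ) =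
        1 / 9 * (1 / (1 + 19 * ((n : ℕ) : ℝ))) := fun n => by
      rw [NNReal.coe_div, NNReal.coe_one, NNReal.coe_ofNat, ← Real.sqrt_eq_rpow,
        Real.sqrt_sq (by positivity), one_div_mul_one_div]
    simp only [h1, ← Finset.mul_sum]
    linarith
  · rintro x ⟨w, hw⟩
    have key : ∀ n m, ∀ y ∈ levelSet (inverseBranch ε) (fun _ => 0) m,
        nestedComp (fun _ (n : Fin (N + 1)) => (moebiusInverse ε)^[(n : ℕ)] ∘ g) w n y ∈
          levelSet (inverseBranch ε) (fun _ => 0) (m + n) := by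
      intro n
      induction n with
      | zero => exact fun m y hy => hy
      | succ n ih =>
        intro m y hy
        have h := ih (m + 1) _ (hlevel (w n) (m + 1) (g y)
          (mem_levelSet_succ.2 ⟨1, y, hy, rfl⟩))
        rwa [add_assoc, add_comm 1] at h
    refine mem_iInter.2 fun n => ?_
    obtain ⟨y, hy, rfl⟩ := hw n
    have h := key n 0 y (by rwa [levelSet_zero])
    rwa [zero_add] at h

theorem exists_sum_one_div_ge (A : ℝ) :
    ∃ N : ℕ, A ≤ ∑ n : Fin (N + 1), 1 / (1 + 19 * ((n : ℕ) : ℝ)) := by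
  obtain ⟨N, hN⟩ := (Real.tendsto_sum_range_one_div_nat_succ_atTop.eventually_ge_atTop
    (20 * A)).exists
  refine ⟨N, ?_⟩
  rw [Fin.sum_univ_eq_sum_range (fun n => 1 / (1 + 19 * (n : ℝ))), Finset.sum_range_succ]
  have h : ∑ n ∈ Finset.range N, 1 / 20 * (1 / ((n : ℝ) + 1)) ≤
      ∑ n ∈ Finset.range N, 1 / (1 + 19 * (n : ℝ)) := by
    refine Finset.sum_le_sum fun n _ => ?_
    rw [one_div_mul_one_div]
    refine one_div_le_one_div_of_le (by positivity) ?_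
    have : (0 : ℝ) ≤ n := n.cast_nonneg
    linarith
  rw [← Finset.mul_sum] at h
  have : (0 : ℝ) ≤ 1 / (1 + 19 * (N : ℝ)) := by positivity
  linarith

end LowerBound

/-! ### Upper bound `3/8` for the alternating system. -/

section UpperBound

theorem sum_branch_add_two (B : Fin 2 → Fin 2 → ℝ → ℝ) (c : ℕ → Fin 2) (n : ℕ)
    (g : (ℝ → ℝ) → ℝ) : ∑ w : Fin (n + 2) → Fin 2, g (branch B c (n + 2) w) =
      ∑ i, ∑ i', ∑ w : Fin n → Fin 2,
        g (B (c 0) i ∘ B (c 1) i' ∘ branch B (fun k => c (k + 2)) n w) := by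
  rw [sum_branch_succ]
  exact Finset.sum_congr rfl fun i _ =>
    sum_branch_succ B (fun k => c (k + 1)) n fun h => g (B (c 0) i ∘ h)

theorem inverseBranch_sub_nonneg {ε : ℝ} (hε : 0 < ε) (j i : Fin 2) {x y : ℝ}
    (hx : x ∈ Icc (0 : ℝ) 1) (hy : y ∈ Icc (0 : ℝ) 1) (hxy : y ≤ x) :
    0 ≤ inverseBranch ε j i x - inverseBranch ε j i y := by
  have h0 : ∀ {x y : ℝ}, x ∈ Icc (0 : ℝ) 1 → y ∈ Icc (0 : ℝ) 1 → y ≤ x →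
      0 ≤ moebiusInverse ε x - moebiusInverse ε y := fun hx hy hxy => by
    rw [moebiusInverse_sub hε hx hy]
    have := moebiusInverse_den_pos hε hx
    have := moebiusInverse_den_pos hε hy
    have := sub_nonneg.2 hxy
    positivity
  fin_cases j <;> fin_cases i
  · exact h0 hx hy hxy
  · change 0 ≤ (x + 19) / 20 - (y + 19) / 20
    linarith
  · change 0 ≤ 1 - moebiusInverse ε (1 - x) - (1 - moebiusInverse ε (1 - y))
    have := h0 (one_sub_mem_unitInterval hy) (one_sub_mem_unitInterval hx) (by linarith)
    linarith
  · change 0 ≤ 1 - (1 - x + 19) / 20 - (1 - (1 - y + 19) / 20)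
    linarith

theorem moebiusInverse_sub_le {ε : ℝ} (hε : 0 < ε) (hε' : ε ≤ 1 / 10) {x y : ℝ}
    (hx : x ∈ Icc (0 : ℝ) 1) (hy : y ∈ Icc (0 : ℝ) 1) (hxy : y ≤ x) :
    moebiusInverse ε x - moebiusInverse ε y ≤ x - y := by
  rw [moebiusInverse_sub hε hx hy]
  refine mul_le_of_le_one_right (sub_nonneg.2 hxy) ?_
  have h1 : 1 + ε ≤ (1 + ε) + (19 - ε) * x := by nlinarith [hx.1]
  have h2 : 1 ≤ (1 + ε) + (19 - ε) * y := by nlinarith [hy.1]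
  rw [div_le_one (mul_pos (by linarith) (by linarith))]
  nlinarith

theorem moebiusInverse_sub_le_of_near_one {ε : ℝ} (hε : 0 < ε) (hε' : ε ≤ 1 / 10) {x y : ℝ}
    (hx : x ∈ Icc (19 / 20 : ℝ) 1) (hy : y ∈ Icc (19 / 20 : ℝ) 1) (hxy : y ≤ x) :
    moebiusInverse ε x - moebiusInverse ε y ≤ 1 / 256 * (x - y) := by
  have hsub : Icc (19 / 20 : ℝ) 1 ⊆ Icc 0 1 := Icc_subset_Icc_left (by norm_num)
  rw [moebiusInverse_sub hε (hsub hx) (hsub hy), mul_comm]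
  refine mul_le_mul_of_nonneg_right ?_ (sub_nonneg.2 hxy)
  have h1 : 18 ≤ (1 + ε) + (19 - ε) * x := by nlinarith [hx.1]
  have h2 : 18 ≤ (1 + ε) + (19 - ε) * y := by nlinarith [hy.1]
  rw [div_le_div_iff₀ (mul_pos (by linarith) (by linarith)) (by norm_num)]
  nlinarith

/-- Upper contraction ratios of the inverse branches of `F₀ ∘ F₁`. -/
noncomputable def pairRatio : Fin 2 → Fin 2 → ℝ := ![![1 / 256, 1 / 16], ![1 / 16, 1 / 256]]

/-- The Möbius branch of letter `0` lands in `[0, 1/20]`, far from the slow point `1` of letter `1`,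
so two Möbius branches in a row still contract strongly. In the other pairs an affine branch
contributes `1/20`, or two of them `1/400`. -/
theorem inverseBranch_pair_sub_le {ε : ℝ} (hε : 0 < ε) (hε' : ε ≤ 1 / 10) (i i' : Fin 2) {x y : ℝ}
    (hx : x ∈ Icc (0 : ℝ) 1) (hy : y ∈ Icc (0 : ℝ) 1) (hxy : y ≤ x) :
    inverseBranch ε 1 i (inverseBranch ε 0 i' x) - inverseBranch ε 1 i (inverseBranch ε 0 i' y) ≤
      pairRatio i i' * (x - y) := by
  have hm := moebiusInverse_sub_le hε hε' hx hy hxy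
  have hm0 := inverseBranch_sub_nonneg hε 0 0 hx hy hxy
  change 0 ≤ moebiusInverse ε x - moebiusInverse ε y at hm0
  have hmx := moebiusInverse_mem hε hx
  have hmy := moebiusInverse_mem hε hy
  fin_cases i <;> fin_cases i'
  · change 1 - moebiusInverse ε (1 - moebiusInverse ε x) -
      (1 - moebiusInverse ε (1 - moebiusInverse ε y)) ≤ 1 / 256 * (x - y)
    have h := moebiusInverse_sub_le_of_near_one hε hε' (x := 1 - moebiusInverse ε y)
      (y := 1 - moebiusInverse ε x) ⟨by linarith [hmy.2], by linarith [hmy.1]⟩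
      ⟨by linarith [hmx.2], by linarith [hmx.1]⟩ (by linarith)
    linarith
  · change 1 - moebiusInverse ε (1 - (x + 19) / 20) - (1 - moebiusInverse ε (1 - (y + 19) / 20)) ≤
      1 / 16 * (x - y)
    have h := moebiusInverse_sub_le hε hε' (x := 1 - (y + 19) / 20) (y := 1 - (x + 19) / 20)
      ⟨by linarith [hy.2], by linarith [hy.1]⟩ ⟨by linarith [hx.2], by linarith [hx.1]⟩
      (by linarith)
    linarith
  · change 1 - (1 - moebiusInverse ε x + 19) / 20 - (1 - (1 - moebiusInverse ε y + 19) / 20) ≤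
      1 / 16 * (x - y)
    linarith
  · change 1 - (1 - (x + 19) / 20 + 19) / 20 - (1 - (1 - (y + 19) / 20 + 19) / 20) ≤
      1 / 256 * (x - y)
    linarith

theorem sum_pairRatio_rpow_le :
    ∑ i, ∑ i', pairRatio i i' ^ ((3 / 8 : ℝ≥0) : ℝ) ≤ 1 := by
  -- The four powers are at most `1/8, 3/8, 3/8, 1/8`, with sum exactly `1`; this reduces them to
  -- integer powers.
  have key : ∀ {x y : ℝ}, 0 ≤ x → 0 ≤ y → x ^ 3 ≤ y ^ 8 → x ^ ((3 / 8 : ℝ≥0) : ℝ) ≤ y := by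
    intro x y hx hy h
    have h1 : x ^ ((3 / 8 : ℝ≥0) : ℝ) = (x ^ 3) ^ ((8 : ℕ) : ℝ)⁻¹ := by
      rw [← Real.rpow_natCast, ← Real.rpow_mul hx]
      norm_num
    rw [h1, ← Real.pow_rpow_inv_natCast hy (n := 8) (by norm_num)]
    exact Real.rpow_le_rpow (by positivity) h (by positivity)
  have h1 : (1 / 16 : ℝ) ^ ((3 / 8 : ℝ≥0) : ℝ) ≤ 3 / 8 :=
    key (by norm_num) (by norm_num) (by norm_num)
  have h2 : (1 / 256 : ℝ) ^ ((3 / 8 : ℝ≥0) : ℝ) ≤ 1 / 8 :=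
    key (by norm_num) (by norm_num) (by norm_num)
  rw [Fin.sum_univ_two, Fin.sum_univ_two, Fin.sum_univ_two]
  change (1 / 256 : ℝ) ^ ((3 / 8 : ℝ≥0) : ℝ) + (1 / 16 : ℝ) ^ ((3 / 8 : ℝ≥0) : ℝ) +
    ((1 / 16 : ℝ) ^ ((3 / 8 : ℝ≥0) : ℝ) + (1 / 256 : ℝ) ^ ((3 / 8 : ℝ≥0) : ℝ)) ≤ 1
  linarith

theorem lengthSum_alternating_le_one {ε ρ lam M δ : ℝ} (hε : 0 < ε) (hε' : ε ≤ 1 / 10)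
    (hB : IsMoebiusSystem (inverseBranch ε) ρ lam M δ) {c : ℕ → Fin 2} (hc0 : c 0 = 1)
    (hc1 : c 1 = 0) (hc : ∀ k, c (k + 2) = c k) (n : ℕ) :
    lengthSum (inverseBranch ε) c (2 * n) ((3 / 8 : ℝ≥0) : ℝ) ≤ 1 := by
  induction n with
  | zero => rw [mul_zero, IsMoebiusSystem.lengthSum_zero]
  | succ n ih =>
    rw [mul_add, mul_one, lengthSum, sum_branch_add_two _ c (2 * n) fun h => (h 1 - h 0) ^ _]
    have hcc : (fun k => c (k + 2)) = c := funext hc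
    simp only [hcc, hc0, hc1, Function.comp_apply]
    calc _ ≤ ∑ i, ∑ i', ∑ w : Fin (2 * n) → Fin 2, pairRatio i i' ^ ((3 / 8 : ℝ≥0) : ℝ) *
          (branch (inverseBranch ε) c (2 * n) w 1 - branch (inverseBranch ε) c (2 * n) w 0) ^
            ((3 / 8 : ℝ≥0) : ℝ) := by
          refine Finset.sum_le_sum fun i _ => Finset.sum_le_sum fun i' _ =>
            Finset.sum_le_sum fun w _ => ?_
          have h1 := hB.branch_mapsTo c (2 * n) w (x := 1) (by simp)
          have h0 := hB.branch_mapsTo c (2 * n) w (x := 0) (by simp)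
          have hl := hB.length_pos c (2 * n) w
          have hle : branch (inverseBranch ε) c (2 * n) w 0 ≤
            branch (inverseBranch ε) c (2 * n) w 1 := by linarith
          have hr : 0 ≤ pairRatio i i' := by
            fin_cases i <;> fin_cases i' <;> norm_num [pairRatio]
          rw [← Real.mul_rpow hr hl.le]
          refine Real.rpow_le_rpow ?_ (inverseBranch_pair_sub_le hε hε' i i' h1 h0 hle)
            (NNReal.coe_nonneg _)
          exact inverseBranch_sub_nonneg hε 1 i (hB.mapsTo 0 i' h1) (hB.mapsTo 0 i' h0)
            (sub_nonneg.1 (inverseBranch_sub_nonneg hε 0 i' h1 h0 hle))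
      _ = (∑ i, ∑ i', pairRatio i i' ^ ((3 / 8 : ℝ≥0) : ℝ)) *
          lengthSum (inverseBranch ε) c (2 * n) ((3 / 8 : ℝ≥0) : ℝ) := by
          simp only [lengthSum, ← Finset.mul_sum, ← Finset.sum_mul]
      _ ≤ 1 := mul_le_one₀ sum_pairRatio_rpow_le (hB.lengthSum_nonneg _ _ _) ih

end UpperBound

/-! ### Alternating sequences and admissibility of small parameters. -/

/-- The two-periodic sequence `a b a b ⋯`. -/
def alternating (a b : Fin 2) (k : ℕ) : Fin 2 := if k % 2 = 0 then a else b

theorem alternating_two_mul (a b : Fin 2) (n : ℕ) : alternating a b (2 * n) = a := by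
  simp [alternating]

theorem alternating_two_mul_add_one (a b : Fin 2) (n : ℕ) : alternating a b (2 * n + 1) = b := by
  simp [alternating, Nat.add_mod]

theorem alternating_add_two (a b : Fin 2) (k : ℕ) :
    alternating a b (k + 2) = alternating a b k := by
  simp [alternating]

theorem alternating_self (a : Fin 2) : alternating a a = fun _ => a := by
  funext k
  simp [alternating]

theorem dimH_cookieCutterSet_zero_eq_one {ε : ℝ} (hε : 0 < ε) :
    dimH (cookieCutterSet (exampleMap ε 0)) = dimH (cookieCutterSet (exampleMap ε 1)) := by
  rw [cookieCutterSet_exampleMap hε, cookieCutterSet_exampleMap hε]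
  exact (dimH_limitSet_rev ε fun _ => 0).symm

theorem exists_admissible :
    ∃ ε₀ : ℝ, 0 < ε₀ ∧ ∀ ε : ℝ, 0 < ε → ε < ε₀ → IsAdmissibleParameter ε := by
  obtain ⟨N, hN⟩ := exists_sum_one_div_ge 9
  -- `N` is fixed first by the harmonic sum; then `N * ε ≤ 1` keeps `(1 + ε) ^ N` below `e`, so the
  -- first `N` iterates look parabolic.
  refine ⟨min (1 / 10) (1 / ((N : ℝ) + 1)), by positivity, fun ε hε hlt => ?_⟩
  have h1 : ε ≤ 1 / 10 := (hlt.trans_le (min_le_left _ _)).le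
  have h2 : ε ≤ 1 / ((N : ℝ) + 1) := (hlt.trans_le (min_le_right _ _)).le
  have hpow : (1 + ε) ^ N ≤ 4 := by
    have h3 : (N : ℝ) * ε ≤ 1 := by
      rw [le_div_iff₀ (by positivity)] at h2
      nlinarith
    calc (1 + ε) ^ N ≤ Real.exp ε ^ N := by
          gcongr
          linarith [Real.add_one_le_exp ε]
      _ = Real.exp (N * ε) := (Real.exp_nat_mul ε N).symm
      _ ≤ Real.exp 1 := Real.exp_le_exp.2 h3
      _ ≤ 4 := by linarith [Real.exp_one_lt_d9]
  obtain ⟨ρ, lam, M, δ, hB⟩ := exists_isMoebiusSystem hε (by linarith)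
  refine ⟨⟨1, one_pos, isCookieCutter_exampleMap hε (by linarith)⟩, ?_, ?_,
    dimH_cookieCutterSet_zero_eq_one hε⟩
  · rw [cookieCutterSet_comp_exampleMap hε (alternating_two_mul 1 0)
      (alternating_two_mul_add_one 1 0) (hB.levelSet_antitone _)]
    have h : dimH (limitSet (inverseBranch ε) (alternating 1 0)) ≤ (3 / 8 : ℝ≥0) :=
      hB.dimH_limitSet_le _ (A := 1) (frequently_atTop.2 fun n => ⟨2 * n, by omega,
        lengthSum_alternating_le_one hε h1 hB rfl rfl (alternating_add_two 1 0) n⟩)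
    refine h.trans_lt ?_
    rw [← ENNReal.ofReal_coe_nnreal, ENNReal.ofReal_lt_ofReal_iff (by norm_num)]
    norm_num
  · rw [cookieCutterSet_exampleMap hε]
    refine lt_of_lt_of_le ?_ (half_le_dimH_limitSet_zero hε (by linarith) hN hpow
      (hB.levelSet_antitone _))
    rw [← ENNReal.ofReal_coe_nnreal, ENNReal.ofReal_lt_ofReal_iff (by norm_num)]
    norm_num

/-! ### Combinatorics of the block sequence: frequencies and switches. -/

section BlockSequence

/-- The number of pairs of letters before the `j`-th block. -/
def blockStart (l : ℕ → ℕ) (j : ℕ) : ℕ := ∑ i ∈ Finset.range j, l i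

theorem blockStart_succ (l : ℕ → ℕ) (j : ℕ) : blockStart l (j + 1) = blockStart l j + l j :=
  Finset.sum_range_succ _ _

theorem blockStart_mono (l : ℕ → ℕ) : Monotone (blockStart l) :=
  monotone_nat_of_le_succ fun j => by rw [blockStart_succ]; omega

theorem le_blockStart {l : ℕ → ℕ} (hl : ∀ j, 0 < l j) (j : ℕ) : j ≤ blockStart l j := by
  induction j with
  | zero => exact Nat.zero_le _
  | succ j ih => rw [blockStart_succ]; have := hl j; omega

/-- Starting points are counted in pairs, so reading from any even position inside a block begins in
phase with its word. -/
theorem blockSequence_eq_alternating {l : ℕ → ℕ} {j t k : ℕ} (h1 : blockStart l j ≤ t)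
    (h2 : 2 * t + k < 2 * blockStart l (j + 1)) :
    blockSequence l (k + 2 * t) = alternating (blockWord j 0) (blockWord j 1) k := by
  have hinf : sInf {i | (k + 2 * t) / 2 < ∑ i ∈ Finset.range (i + 1), l i} = j := by
    refine le_antisymm (Nat.sInf_le ?_) (le_csInf ⟨j, ?_⟩ fun i hi => ?_)
    · change (k + 2 * t) / 2 < blockStart l (j + 1)
      omega
    · change (k + 2 * t) / 2 < blockStart l (j + 1)
      omega
    · change (k + 2 * t) / 2 < blockStart l (i + 1) at hi
      by_contra! hij
      have := blockStart_mono l (show i + 1 ≤ j from hij)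
      omega
  rw [blockSequence, hinf, alternating]
  rcases Nat.mod_two_eq_zero_or_one k with h | h
  · rw [if_pos h]
    congr 1
    exact Fin.ext (by simp [h])
  · rw [if_neg (by omega)]
    congr 1
    exact Fin.ext (by simp [h])

theorem blockWord_mod (j : ℕ) : blockWord (j % 3) = blockWord j := by
  simp [blockWord]

/-- The quotients `σ j` satisfy `σ (j + 1) = (σ j + 1) * (l (j + 1) / l j)⁻¹`. Once the growth ratio
is at least `2` they remain bounded, and the recursion then forces them to `0`. -/
theorem tendsto_blockStart_div {l : ℕ → ℕ} (hl : ∀ j, 0 < l j)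
    (hlim : Tendsto (fun j => (l (j + 1) : ℝ) / (l j : ℝ)) atTop atTop) :
    Tendsto (fun j => (blockStart l j : ℝ) / l j) atTop (𝓝 0) := by
  have hl' : ∀ j, (0 : ℝ) < l j := fun j => Nat.cast_pos.2 (hl j)
  have hrec : ∀ j, (blockStart l (j + 1) : ℝ) / l (j + 1) =
      ((blockStart l j : ℝ) / l j + 1) * ((l (j + 1) : ℝ) / l j)⁻¹ := fun j => by
    have h1 := (hl' j).ne'
    have h2 := (hl' (j + 1)).ne'
    rw [blockStart_succ]
    push_cast
    field_simp
  obtain ⟨j₀, hj₀⟩ := eventually_atTop.1 (hlim.eventually_ge_atTop 2)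
  set A := max ((blockStart l j₀ : ℝ) / l j₀) 1
  have hbound : ∀ j ≥ j₀, (blockStart l j : ℝ) / l j ≤ A := by
    intro j hj
    induction j, hj using Nat.le_induction with
    | base => exact le_max_left _ _
    | succ j hj ih =>
      have h1 : ((l (j + 1) : ℝ) / l j)⁻¹ ≤ 1 / 2 := by
        rw [← one_div]
        exact one_div_le_one_div_of_le (by norm_num) (hj₀ j hj)
      have h2 : (1 : ℝ) ≤ A := le_max_right _ _
      have h3 : (0 : ℝ) ≤ (blockStart l j : ℝ) / l j := by positivity
      rw [hrec]
      calc _ ≤ ((blockStart l j : ℝ) / l j + 1) * (1 / 2) := by gcongr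
        _ ≤ A := by linarith
  rw [← tendsto_add_atTop_iff_nat 1]
  have hz : Tendsto (fun j => (A + 1) * ((l (j + 1) : ℝ) / l j)⁻¹) atTop (𝓝 0) := by
    simpa using (tendsto_inv_atTop_zero.comp hlim).const_mul (A + 1)
  refine squeeze_zero' (Eventually.of_forall fun j => by positivity) ?_ hz
  filter_upwards [eventually_ge_atTop j₀] with j hj
  rw [hrec]
  have := hbound j hj
  gcongr

theorem eventually_mul_blockStart_le {l : ℕ → ℕ} (hl : ∀ j, 0 < l j)
    (hlim : Tendsto (fun j => (l (j + 1) : ℝ) / (l j : ℝ)) atTop atTop) (q : ℕ) :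
    ∀ᶠ j in atTop, q * blockStart l j ≤ l j := by
  have h : (0 : ℝ) < 1 / ((q : ℝ) + 1) := by positivity
  filter_upwards [(tendsto_blockStart_div hl hlim).eventually_le_const h] with j hj
  have hlj : (0 : ℝ) < l j := Nat.cast_pos.2 (hl j)
  rw [div_le_div_iff₀ hlj (by positivity), one_mul] at hj
  have : (0 : ℝ) ≤ blockStart l j := Nat.cast_nonneg _
  exact_mod_cast (by nlinarith : (q : ℝ) * blockStart l j ≤ l j)

theorem frequently_mod_three {r : ℕ} (hr : r < 3) : ∃ᶠ j in atTop, j % 3 = r :=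
  frequently_atTop.2 fun a => ⟨3 * a + r, by omega, by omega⟩

theorem blockWord_of_mod_zero {j : ℕ} (h : j % 3 = 0) (i : Fin 2) : blockWord j i = 0 := by
  fin_cases i <;> simp [blockWord, h]

theorem blockWord_of_mod_one {j : ℕ} (h : j % 3 = 1) (i : Fin 2) : blockWord j i = 1 := by
  fin_cases i <;> simp [blockWord, h]

theorem blockWord_of_mod_two {j : ℕ} (h : j % 3 = 2) : blockWord j = ![0, 1] := by
  simp [blockWord, h]

theorem blockSequence_eq_of_constant {l : ℕ → ℕ} {j : ℕ} {a : Fin 2}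
    (ha : ∀ i, blockWord j i = a) {m : ℕ} (h1 : 2 * blockStart l j ≤ m)
    (h2 : m < 2 * blockStart l (j + 1)) : blockSequence l m = a := by
  obtain ⟨k, rfl⟩ := Nat.exists_eq_add_of_le h1
  rw [add_comm, blockSequence_eq_alternating le_rfl h2, ha, ha, alternating_self]

theorem letterFreq_le_one {ι : Type*} [DecidableEq ι] (c : ℕ → ι) (n : ℕ) (j : ι) :
    letterFreq c n j ≤ 1 := by
  refine div_le_one_of_le₀ ?_ n.cast_nonneg
  exact_mod_cast (Finset.card_filter_le _ _).trans (Finset.card_range n).le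

theorem letterFreq_nonneg {ι : Type*} [DecidableEq ι] (c : ℕ → ι) (n : ℕ) (j : ι) :
    0 ≤ letterFreq c n j := by
  unfold letterFreq
  positivity

theorem limsup_letterFreq_eq_one {l : ℕ → ℕ} (hl : ∀ j, 0 < l j)
    (hlim : Tendsto (fun j => (l (j + 1) : ℝ) / (l j : ℝ)) atTop atTop) {a : Fin 2} {r : ℕ}
    (hr : r < 3) (ha : ∀ j, j % 3 = r → ∀ i, blockWord j i = a) :
    limsup (fun n => letterFreq (blockSequence l) n a) atTop = 1 := by
  have hbdd : IsBoundedUnder (· ≤ ·) atTop fun n => letterFreq (blockSequence l) n a :=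
    isBoundedUnder_of ⟨1, fun n => letterFreq_le_one _ n a⟩
  have hcobdd : IsCoboundedUnder (· ≤ ·) atTop fun n => letterFreq (blockSequence l) n a :=
    (isBoundedUnder_of ⟨0, fun n => letterFreq_nonneg _ n a⟩ :
      IsBoundedUnder (· ≥ ·) atTop _).isCoboundedUnder_le
  refine le_antisymm (limsup_le_of_le hcobdd (Eventually.of_forall fun n =>
    letterFreq_le_one _ n a)) (le_of_forall_lt fun b hb => ?_)
  -- A positive `b'` allows the condition `l j / (blockStart l j + l j) ≥ b'` to be rewritten as an
  -- upper bound on `blockStart l j / l j`.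
  obtain ⟨b', hbb', hb'⟩ := exists_between (max_lt hb zero_lt_one)
  refine ((le_max_left b 0).trans_lt hbb').trans_le
    (le_limsup_of_frequently_le (frequently_atTop.2 fun n₀ => ?_) hbdd)
  have hb0 : 0 < b' := (le_max_right b 0).trans_lt hbb'
  have hev := (tendsto_blockStart_div hl hlim).eventually_le_const
    (show 0 < (1 - b') / b' from div_pos (by linarith) hb0)
  obtain ⟨j, hjr, hj, hjn⟩ :=
    ((frequently_mod_three hr).and_eventually (hev.and (eventually_ge_atTop n₀))).exists
  have hlj : (0 : ℝ) < l j := Nat.cast_pos.2 (hl j)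
  refine ⟨2 * blockStart l (j + 1), ?_, ?_⟩
  · have := le_blockStart hl (j + 1)
    omega
  have hcard : 2 * l j ≤
      ((Finset.range (2 * blockStart l (j + 1))).filter fun m => blockSequence l m = a).card := by
    have h1 : (Finset.Ico (2 * blockStart l j) (2 * blockStart l (j + 1))).card = 2 * l j := by
      rw [Nat.card_Ico, blockStart_succ]; omega
    rw [← h1]
    refine Finset.card_le_card fun m hm => ?_
    rw [Finset.mem_Ico] at hm
    exact Finset.mem_filter.2 ⟨Finset.mem_range.2 hm.2,
      blockSequence_eq_of_constant (ha j hjr) hm.1 hm.2⟩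
  have hcard' : (2 * l j : ℝ) ≤ (((Finset.range (2 * blockStart l (j + 1))).filter
      fun m => blockSequence l m = a).card : ℝ) := by exact_mod_cast hcard
  rw [div_le_div_iff₀ hlj hb0] at hj
  have hpos : (0 : ℝ) < (2 * blockStart l (j + 1) : ℕ) := by
    rw [blockStart_succ]
    have := hl j
    exact_mod_cast (by omega : 0 < 2 * (blockStart l j + l j))
  rw [letterFreq, le_div_iff₀ hpos, blockStart_succ]
  rw [blockStart_succ] at hcard'
  push_cast
  linarith

theorem frequenciesCondition_blockSequence {l : ℕ → ℕ} (hl : ∀ j, 0 < l j)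
    (hlim : Tendsto (fun j => (l (j + 1) : ℝ) / (l j : ℝ)) atTop atTop) :
    FrequenciesCondition (blockSequence l) := by
  intro a
  fin_cases a
  · exact limsup_letterFreq_eq_one hl hlim (r := 0) (by norm_num) fun j => blockWord_of_mod_zero
  · exact limsup_letterFreq_eq_one hl hlim (r := 1) (by norm_num) fun j => blockWord_of_mod_one

theorem not_rarelySwitching_blockSequence {l : ℕ → ℕ} (hl : ∀ j, 0 < l j)
    (hlim : Tendsto (fun j => (l (j + 1) : ℝ) / (l j : ℝ)) atTop atTop) :
    ¬ RarelySwitching (blockSequence l) := by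
  intro hrare
  obtain ⟨n₀, hn₀⟩ := eventually_atTop.1 (hrare.def (show (0 : ℝ) < 1 / 8 by norm_num))
  obtain ⟨j, hjr, hj, hjn⟩ := ((frequently_mod_three (r := 2) (by norm_num)).and_eventually
    ((eventually_mul_blockStart_le hl hlim 1).and (eventually_ge_atTop n₀))).exists
  -- Every pair of an `(01)` block contains a switch, and for the chosen `j` the total number of
  -- letters is at most `4 * l j`; so the switches have density at least `1/4`, beyond the tested
  -- `1/8`.
  have hcard : l j ≤ switchCount (blockSequence l) (2 * blockStart l (j + 1)) := by
    have h1 : ((Finset.Ico (blockStart l j) (blockStart l (j + 1))).image fun t => 2 * t).card =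
        l j := by
      rw [Finset.card_image_of_injective _ fun a b h => by simpa using h, Nat.card_Ico,
        blockStart_succ, Nat.add_sub_cancel_left]
    refine h1.symm.le.trans (Finset.card_le_card fun m hm => ?_)
    obtain ⟨t, ht, rfl⟩ := Finset.mem_image.1 hm
    rw [Finset.mem_Ico] at ht
    refine Finset.mem_filter.2 ⟨Finset.mem_range.2 (by omega), ?_⟩
    have e0 := blockSequence_eq_alternating (k := 0) ht.1 (by omega)
    have e1 := blockSequence_eq_alternating (k := 1) ht.1 (by omega)
    rw [zero_add] at e0
    rw [add_comm] at e1
    rw [e0, e1, blockWord_of_mod_two hjr]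
    simp [alternating]
  have hn := hn₀ (2 * blockStart l (j + 1)) (by
    have := le_blockStart hl (j + 1)
    omega)
  rw [Real.norm_natCast, Real.norm_natCast] at hn
  have hcard' : (l j : ℝ) ≤ switchCount (blockSequence l) (2 * blockStart l (j + 1)) := by
    exact_mod_cast hcard
  have h2 : ((2 * blockStart l (j + 1) : ℕ) : ℝ) = 2 * (blockStart l j + l j) := by
    rw [blockStart_succ]; push_cast; ring
  have h3 : (blockStart l j : ℝ) ≤ l j := by rw [one_mul] at hj; exact_mod_cast hj
  have h4 : (0 : ℝ) < l j := Nat.cast_pos.2 (hl j)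
  rw [h2] at hn
  linarith

end BlockSequence

/-! ### Dimension of the limit set of the block sequence. -/

section Dimension

variable {B : Fin 2 → Fin 2 → ℝ → ℝ} {ρ lam M δ : ℝ}

theorem dimH_limitSet_blockSequence_le (hB : IsMoebiusSystem B ρ lam M δ) {l : ℕ → ℕ}
    (hl : ∀ j, 0 < l j) (hlim : Tendsto (fun j => (l (j + 1) : ℝ) / (l j : ℝ)) atTop atTop) :
    dimH (limitSet B (blockSequence l)) ≤ dimH (limitSet B (alternating 0 1)) := by
  refine le_of_forall_gt fun s' hs' => ?_
  obtain ⟨s, hs, hss'⟩ := ENNReal.lt_iff_exists_nnreal_btwn.1 hs'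
  refine lt_of_le_of_lt ?_ hss'
  obtain ⟨A, r, hA, hr0, hr1, hAr⟩ :=
    hB.exists_lengthSum_le_geometric two_pos (alternating_add_two 0 1) hs
  -- Before the block there are `4 ^ blockStart l j` cylinders; a block `q` times longer than its
  -- past absorbs this factor.
  obtain ⟨q, hq⟩ := exists_pow_lt_of_lt_one (show (0 : ℝ) < 1 / 4 by norm_num) hr1
  have hK : 0 < distortion ρ M ^ (s : ℝ) := Real.rpow_pos_of_pos hB.distortion_pos _
  refine hB.dimH_limitSet_le _ (A := distortion ρ M ^ (s : ℝ) * A) (frequently_atTop.2 fun n₀ => ?_)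
  obtain ⟨j, hjr, hj, hjn⟩ := ((frequently_mod_three (r := 2) (by norm_num)).and_eventually
    ((eventually_mul_blockStart_le hl hlim q).and (eventually_ge_atTop n₀))).exists
  refine ⟨2 * blockStart l j + 2 * l j, ?_, ?_⟩
  · have := le_blockStart hl j
    omega
  have hblock : lengthSum B (fun k => blockSequence l (k + 2 * blockStart l j)) (2 * l j) s =
      lengthSum B (alternating 0 1) (2 * l j) s := by
    refine lengthSum_congr B (fun k hk => ?_) _
    rw [blockSequence_eq_alternating le_rfl (by rw [blockStart_succ]; omega),
      blockWord_of_mod_two hjr]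
    rfl
  have hsmall : (2 : ℝ) ^ (2 * blockStart l j) * r ^ l j ≤ 1 := by
    calc (2 : ℝ) ^ (2 * blockStart l j) * r ^ l j ≤
          4 ^ blockStart l j * r ^ (q * blockStart l j) := by
          rw [pow_mul]
          norm_num only
          gcongr ?_ * ?_
          exact pow_le_pow_of_le_one hr0 hr1.le hj
      _ = (4 * r ^ q) ^ blockStart l j := by rw [pow_mul, mul_pow]
      _ ≤ 1 := pow_le_one₀ (by positivity) (by linarith)
  calc lengthSum B (blockSequence l) (2 * blockStart l j + 2 * l j) s
      ≤ distortion ρ M ^ (s : ℝ) * (lengthSum B (blockSequence l) (2 * blockStart l j) s *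
          lengthSum B (alternating 0 1) (2 * l j) s) := by
        rw [← hblock]
        exact hB.lengthSum_add_le _ _ _ s.coe_nonneg
    _ ≤ distortion ρ M ^ (s : ℝ) * (2 ^ (2 * blockStart l j) * (A * r ^ l j)) := by
        have h1 := hB.lengthSum_le_two_pow (blockSequence l) (2 * blockStart l j) s.coe_nonneg
        have h2 := hAr (l j)
        have h3 := hB.lengthSum_nonneg (alternating 0 1) (2 * l j) s
        gcongr
    _ = distortion ρ M ^ (s : ℝ) * A * (2 ^ (2 * blockStart l j) * r ^ l j) := by ring
    _ ≤ _ := mul_le_of_le_one_right (by positivity) hsmall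

/-- Cut points in the blocks, with gaps between `N` and `2 N`, such that no gap crosses the end of
a block. -/
theorem exists_block_cuts {l : ℕ → ℕ} {N j₀ : ℕ} (hj₀ : ∀ j ≥ j₀, N ≤ l j) :
    ∃ t d : ℕ → ℕ, t 0 = 0 ∧ (∀ k, t (k + 1) = t k + d k) ∧ (∀ k, N ≤ d k ∧ d k ≤ 2 * N) ∧
      ∀ k, ∃ j, blockStart l j ≤ blockStart l j₀ + t k ∧
        blockStart l j₀ + t k + d k ≤ blockStart l (j + 1) := by
  -- Invariant: at least `N` pairs remain in the current block. With `2 * N` or more remaining,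
  -- advance by `N`; otherwise take the whole remainder and enter the next block, which has length
  -- at least `N`.
  set good : ℕ → Prop := fun t => ∃ j ≥ j₀, blockStart l j ≤ blockStart l j₀ + t ∧
    blockStart l j₀ + t + N ≤ blockStart l (j + 1)
  have hstep : ∀ t, good t → ∃ d, (N ≤ d ∧ d ≤ 2 * N) ∧ good (t + d) ∧
      ∃ j, blockStart l j ≤ blockStart l j₀ + t ∧
        blockStart l j₀ + t + d ≤ blockStart l (j + 1) := by
    rintro t ⟨j, hj, h1, h2⟩
    by_cases h : blockStart l j₀ + t + 2 * N ≤ blockStart l (j + 1)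
    · exact ⟨N, by omega, ⟨j, hj, by omega, by omega⟩, j, h1, h2⟩
    · refine ⟨blockStart l (j + 1) - (blockStart l j₀ + t), by omega,
        ⟨j + 1, by omega, by omega, ?_⟩, j, h1, by omega⟩
      have := hj₀ (j + 1) (by omega)
      rw [blockStart_succ l (j + 1)]
      omega
  choose! d hd hgood hj using hstep
  have h0 : good 0 := ⟨j₀, le_rfl, by omega, by
    rw [blockStart_succ]
    have := hj₀ j₀ le_rfl
    omega⟩
  set T : ℕ → ℕ := fun k => Nat.rec 0 (fun _ t => t + d t) k
  have hT : ∀ k, good (T k) := fun k => by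
    induction k with
    | zero => exact h0
    | succ k ih => exact hgood _ ih
  exact ⟨T, fun k => d (T k), rfl, fun k => rfl, fun k => hd _ (hT k), fun k => hj _ (hT k)⟩

/-- There are only three block words, so one `N` makes every piece of at least `N` pairs heavy
enough; the initial short blocks are removed by a shift. -/
theorem le_dimH_limitSet_blockSequence (hB : IsMoebiusSystem B ρ lam M δ) {l : ℕ → ℕ}
    (hl : ∀ j, 0 < l j) (hlim : Tendsto (fun j => (l (j + 1) : ℝ) / (l j : ℝ)) atTop atTop)
    {D : ℝ≥0∞} (hD : ∀ j, D ≤ dimH (limitSet B (alternating (blockWord j 0) (blockWord j 1)))) :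
    D ≤ dimH (limitSet B (blockSequence l)) := by
  refine le_of_forall_lt fun s' hs' => ?_
  obtain ⟨s, hss', hs⟩ := ENNReal.lt_iff_exists_nnreal_btwn.1 hs'
  refine lt_of_lt_of_le hss' ?_
  have hev : ∀ᶠ n in atTop, ∀ j : Fin 3, distortion ρ M ^ (s : ℝ) ≤
      lengthSum B (alternating (blockWord j 0) (blockWord j 1)) (2 * n) s :=
    eventually_all.2 fun j => hB.eventually_le_lengthSum two_pos (alternating_add_two _ _)
      (hs.trans_le (hD j)) _
  obtain ⟨N, hN⟩ := eventually_atTop.1 (hev.and (eventually_ge_atTop 1))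
  have hN1 : 1 ≤ N := (hN N le_rfl).2
  have hlN : ∀ᶠ j in atTop, N ≤ l j := by
    filter_upwards [eventually_mul_blockStart_le hl hlim 1, eventually_ge_atTop N] with j h1 h2
    have := le_blockStart hl j
    omega
  obtain ⟨j₀, hj₀⟩ := eventually_atTop.1 hlN
  obtain ⟨t, d, ht0, ht, hd, hj⟩ := exists_block_cuts hj₀
  refine (hB.le_dimH_limitSet_of_blocks (fun i => blockSequence l (i + 2 * blockStart l j₀))
    (t := fun k => 2 * t k) (d := fun k => 2 * d k) (by simp [ht0])
    (fun k => by simp only [ht]; ring) (fun k => by have := (hd k).1; omega) (D := 4 * N)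
    (fun k => by have := (hd k).2; omega) fun k => ?_).trans (hB.dimH_limitSet_shift_le _ _)
  obtain ⟨j, h1, h2⟩ := hj k
  have hword := (hN (d k) (hd k).1).1 ⟨j % 3, Nat.mod_lt _ (by norm_num)⟩
  simp only [blockWord_mod] at hword
  refine hword.trans (lengthSum_congr B (fun i hi => ?_) _).le
  rw [show i + 2 * t k + 2 * blockStart l j₀ = i + 2 * (blockStart l j₀ + t k) by ring]
  exact (blockSequence_eq_alternating h1 (by omega)).symm

end Dimension

theorem alternating_rev (a b : Fin 2) :
    (fun k => (alternating a b k).rev) = alternating a.rev b.rev := by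
  funext k
  unfold alternating
  split_ifs <;> rfl

theorem dimH_limitSet_blockSequence {ε : ℝ} (hε : 0 < ε) (h : IsAdmissibleParameter ε) {l : ℕ → ℕ}
    (hl : ∀ j, 0 < l j) (hlim : Tendsto (fun j => (l (j + 1) : ℝ) / (l j : ℝ)) atTop atTop) :
    dimH (cookieCutterLikeSet (exampleMap ε) (blockSequence l)) =
      dimH (cookieCutterSet ((exampleMap ε 0).comp (exampleMap ε 1))) := by
  obtain ⟨⟨τ, -, hcc⟩, hlt, hlt', heq⟩ := h
  obtain ⟨ρ, lam, M, δ, hB⟩ := exists_isMoebiusSystem hε (lt_of_isCookieCutter hε (hcc 0))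
  have hle := (hlt.trans hlt').le
  rw [cookieCutterSet_comp_exampleMap hε (alternating_two_mul 1 0)
    (alternating_two_mul_add_one 1 0) (hB.levelSet_antitone _)] at hle ⊢
  -- `F₀ ∘ F₁` applies letter `1` first, whereas the blocks read `01`; the reflection `x ↦ 1 - x`
  -- exchanges the two orders.
  have hrev : dimH (limitSet (inverseBranch ε) (alternating 1 0)) =
      dimH (limitSet (inverseBranch ε) (alternating 0 1)) := by
    rw [← dimH_limitSet_rev ε (alternating 0 1), alternating_rev]
    rfl
  rw [hrev] at hle ⊢
  rw [cookieCutterLikeSet_exampleMap hε]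
  refine le_antisymm (dimH_limitSet_blockSequence_le hB hl hlim)
    (le_dimH_limitSet_blockSequence hB hl hlim fun j => ?_)
  have hj := Nat.mod_lt j (show 0 < 3 by norm_num)
  interval_cases hm : j % 3
  · rw [blockWord_of_mod_zero hm, blockWord_of_mod_zero hm, alternating_self,
      ← cookieCutterSet_exampleMap hε]
    exact hle
  · rw [blockWord_of_mod_one hm, blockWord_of_mod_one hm, alternating_self,
      ← cookieCutterSet_exampleMap hε, ← heq]
    exact hle
  · rw [blockWord_of_mod_two hm]
    exact le_rfl

theorem mainTheorem6 :
    (∃ ε₀ : ℝ, 0 < ε₀ ∧ ∀ ε : ℝ, 0 < ε → ε < ε₀ → IsAdmissibleParameter ε) ∧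
    ∀ ε : ℝ, 0 < ε → IsAdmissibleParameter ε →
      ∀ l : ℕ → ℕ, (∀ j, 0 < l j) →
        Tendsto (fun j => (l (j + 1) : ℝ) / (l j : ℝ)) atTop atTop →
        dimH (cookieCutterLikeSet (exampleMap ε) (blockSequence l)) =
            dimH (cookieCutterSet ((exampleMap ε 0).comp (exampleMap ε 1))) ∧
        dimH (cookieCutterSet ((exampleMap ε 0).comp (exampleMap ε 1))) <
            dimH (cookieCutterSet (exampleMap ε 0)) ∧
        dimH (cookieCutterSet (exampleMap ε 0)) = dimH (cookieCutterSet (exampleMap ε 1)) ∧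
        FrequenciesCondition (blockSequence l) ∧
        ¬ RarelySwitching (blockSequence l) ∧
        dimH (cookieCutterLikeSet (exampleMap ε) (blockSequence l)) ≠
            ⨅ i, dimH (cookieCutterSet (exampleMap ε i)) := by
  refine ⟨exists_admissible, fun ε hε h l hl hlim => ?_⟩
  have hdim := dimH_limitSet_blockSequence hε h hl hlim
  have hlt := h.2.1.trans h.2.2.1
  refine ⟨hdim, hlt, h.2.2.2, frequenciesCondition_blockSequence hl hlim,
    not_rarelySwitching_blockSequence hl hlim, ne_of_lt ?_⟩
  have hinf : ∀ i, dimH (cookieCutterSet (exampleMap ε 0)) ≤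
      dimH (cookieCutterSet (exampleMap ε i)) := by
    rw [Fin.forall_fin_two]
    exact ⟨le_rfl, h.2.2.2.le⟩
  rw [hdim]
  exact hlt.trans_le (le_iInf hinf)
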